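/- Let $K$ be an algebraically closed field, $Q$ a finite quiver with vertex set $Q_0$, $I$ an admissible ideal of the path algebra $KQ$, $A = KQ/I$, and $\le$ a partial order on $Q_0$. Products of paths are written like compositions of maps ($qp$ means first $p$, then $q$), and modules are finite-dimensional left modules. For $i \in Q_0$ let $e_i$ be the trivial path at $i$, $P(i) = Ae_i$, $I(i) = \operatorname{Hom}_K(e_iA, K)$ and $S(i) = \operatorname{top} P(i)$. Write $[M : S(k)] = \dim_K e_kM$. Let $\Delta(i)$ be the largest factor module of $P(i)$, and $\nabla(i)$ the largest submodule of $I(i)$, with $[\,\cdot : S(k)] = 0$ for all $k \not\le i$. A module $M$ is $\Delta$-good if it has a filtration whose subquotients are isomorphic to standard modules $\Delta(i)$; then $(M : \Delta(i))$ denotes the number of subquotients isomorphic to $\Delta(i)$ in such a filtration. The pair $(A, \le)$ is quasi-hereditary if for all $i, k \in Q_0$: $[\Delta(i) : S(i)] = 1$, and $P(i)$ is $\Delta$-good with $(P(i) : \Delta(k)) = 0$ whenever $k \not\ge i$ and $(P(i) : \Delta(i)) = 1$. It is called 1-quasi-hereditary if, in addition, for all $i, j \in Q_0$: 1. $Q_0$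 has a smallest element, denoted $1$, and a largest element, denoted $n$; 2. $[\Delta(i) : S(j)] = (P(j) : \Delta(i)) = 1$ if $j \le i$; 3. $\operatorname{soc} P(i) \cong \operatorname{top} I(i) \cong S(1)$; 4. there are an injective homomorphism $\Delta(i) \to \Delta(n)$ and a surjective homomorphism $\nabla(n) \to \nabla(i)$. **Theorem.** Let $(A, \le)$ be 1-quasi-hereditary, and let $j, k, i \in Q_0$ with $i \ge j$ and $i \ge k$. Then there are paths $j = \lambda_0 \to \lambda_1 \to \dots \to \lambda_r = i$ in $Q$ with $\lambda_0 \le \lambda_1 \le \dots \le \lambda_r$ and paths $i = \mu_0 \to \mu_1 \to \dots \to \mu_m = k$ in $Q$ with $\mu_0 \ge \mu_1 \ge \dots \ge \mu_m$. For any choice of two such paths let $p(j,i,k) \in P(j)$ be the residue class of the concatenated path $j \to \lambda_1 \to \dots \to i \to \mu_1 \to \dots \to k$, and let $\langle p(j,i,k) \rangle = A \cdot p(j,i,k) \subseteq P(j)$. Then $F(\langle p(j,i,k)\rangle) \subseteq \langle p(j,i,k)\rangle$ for every $F \in \operatorname{End}_A(P(j))$. Hence $\langle p(j,i,k)\rangle$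 is stable under the natural action of the endomorphism ring on $P(j)$, i.e. it is an $\operatorname{End}_A(P(j))^{op}$-submodule of $P(j)$. -/

import Mathlib

universe u v w

noncomputable section

/-! ### The path algebra of a quiver with finitely many vertices -/

section PathAlgebra

variable (K : Type u) [Field K] (V : Type w) [Quiver.{v} V]

/-- The path algebra `K Q`: an element is a family which assigns to each pair of vertices `i`, `j`
a formal `K`-linear combination of the paths from `i` to `j`. (There are finitely many vertices
whenever the ring structure is used, so this is the `K`-vector space with basis all paths.) -/
def PathAlgebra : Type (max u v w) := (i j : V) → (Quiver.Path i j →₀ K)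

instance : AddCommGroup (PathAlgebra K V) :=
  inferInstanceAs (AddCommGroup ((i j : V) → (Quiver.Path i j →₀ K)))

instance : Module K (PathAlgebra K V) :=
  inferInstanceAs (Module K ((i j : V) → (Quiver.Path i j →₀ K)))

variable {K V}

namespace PathAlgebra

@[ext] theorem ext {x y : PathAlgebra K V} (h : ∀ i j, x i j = y i j) : x = y :=
  funext fun i => funext fun j => h i j

@[simp] theorem add_apply (x y : PathAlgebra K V) (i j : V) : (x + y) i j = x i j + y i j := rfl
@[simp] theorem zero_apply (i j : V) : (0 : PathAlgebra K V) i j = 0 := rfl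
@[simp] theorem smul_apply (c : K) (x : PathAlgebra K V) (i j : V) : (c • x) i j = c • x i j := rfl

/-- The bilinear extension of concatenation of paths: `q` after `p`. -/
def concat {i j k : V} (y : Quiver.Path j k →₀ K) (x : Quiver.Path i j →₀ K) :
    Quiver.Path i k →₀ K :=
  y.sum fun q b => x.sum fun p a => Finsupp.single (p.comp q) (b * a)

theorem concat_single_single {i j k : V} (q : Quiver.Path j k) (p : Quiver.Path i j) (b a : K) :
    concat (Finsupp.single q b) (Finsupp.single p a) = Finsupp.single (p.comp q) (b * a) := by
  simp [concat]

@[simp] theorem zero_concat {i j k : V} (x : Quiver.Path i j →₀ K) :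
    concat (0 : Quiver.Path j k →₀ K) x = 0 := by
  simp [concat]

@[simp] theorem concat_zero {i j k : V} (y : Quiver.Path j k →₀ K) :
    concat y (0 : Quiver.Path i j →₀ K) = 0 := by
  simp [concat]

theorem add_concat {i j k : V} (y y' : Quiver.Path j k →₀ K) (x : Quiver.Path i j →₀ K) :
    concat (y + y') x = concat y x + concat y' x := by
  classical
  unfold concat
  rw [Finsupp.sum_add_index']
  · simp
  · intro q b b'
    simp [add_mul, Finsupp.sum_add]

theorem concat_add {i j k : V} (y : Quiver.Path j k →₀ K) (x x' : Quiver.Path i j →₀ K) :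
    concat y (x + x') = concat y x + concat y x' := by
  classical
  unfold concat
  rw [← Finsupp.sum_add]
  congr 1
  funext q b
  rw [Finsupp.sum_add_index']
  · simp
  · intro p a a'
    simp [mul_add]

theorem smul_concat {i j k : V} (c : K) (y : Quiver.Path j k →₀ K) (x : Quiver.Path i j →₀ K) :
    concat (c • y) x = c • concat y x := by
  induction y using Finsupp.induction_linear with
  | zero => simp
  | add y y' h h' => rw [smul_add, add_concat, h, h', add_concat, smul_add]
  | single q b =>
    induction x using Finsupp.induction_linear with
    | zero => simp
    | add x x' h h' => rw [concat_add, h, h', concat_add, smul_add]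
    | single p a =>
      rw [Finsupp.smul_single, concat_single_single, concat_single_single, Finsupp.smul_single,
        smul_eq_mul, smul_eq_mul, mul_assoc]

theorem concat_smul {i j k : V} (c : K) (y : Quiver.Path j k →₀ K) (x : Quiver.Path i j →₀ K) :
    concat y (c • x) = c • concat y x := by
  induction y using Finsupp.induction_linear with
  | zero => simp
  | add y y' h h' => rw [add_concat, h, h', add_concat, smul_add]
  | single q b =>
    induction x using Finsupp.induction_linear with
    | zero => simp
    | add x x' h h' => rw [smul_add, concat_add, h, h', concat_add, smul_add]
    | single p a =>
      rw [Finsupp.smul_single, concat_single_single, concat_single_single, Finsupp.smul_single,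
        smul_eq_mul, smul_eq_mul, mul_left_comm]

theorem concat_assoc {i j k l : V} (z : Quiver.Path k l →₀ K) (y : Quiver.Path j k →₀ K)
    (x : Quiver.Path i j →₀ K) : concat (concat z y) x = concat z (concat y x) := by
  induction z using Finsupp.induction_linear with
  | zero => simp
  | add z z' h h' => rw [add_concat, add_concat, h, h', add_concat]
  | single r c =>
    induction y using Finsupp.induction_linear with
    | zero => simp
    | add y y' h h' => rw [concat_add, add_concat, h, h', add_concat, concat_add]
    | single q b =>
      induction x using Finsupp.induction_linear with
      | zero => simp
      | add x x' h h' => rw [concat_add, h, h', concat_add, concat_add]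
      | single p a => simp only [concat_single_single, mul_assoc, Quiver.Path.comp_assoc]

theorem nil_concat {i j : V} (x : Quiver.Path i j →₀ K) :
    concat (Finsupp.single (Quiver.Path.nil : Quiver.Path j j) 1) x = x := by
  induction x using Finsupp.induction_linear with
  | zero => simp
  | add x x' h h' => rw [concat_add, h, h']
  | single p a => simp [concat_single_single]

theorem concat_nil {i j : V} (y : Quiver.Path i j →₀ K) :
    concat y (Finsupp.single (Quiver.Path.nil : Quiver.Path i i) 1) = y := by
  induction y using Finsupp.induction_linear with
  | zero => simp
  | add x x' h h' => rw [add_concat, h, h']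
  | single p a => simp [concat_single_single]

theorem sum_concat {ι : Type*} {i j k : V} (s : Finset ι) (y : ι → (Quiver.Path j k →₀ K))
    (x : Quiver.Path i j →₀ K) : concat (∑ t ∈ s, y t) x = ∑ t ∈ s, concat (y t) x := by
  classical
  induction s using Finset.induction_on with
  | empty => simp
  | insert a s ha ih => rw [Finset.sum_insert ha, Finset.sum_insert ha, add_concat, ih]

theorem concat_sum {ι : Type*} {i j k : V} (s : Finset ι) (y : Quiver.Path j k →₀ K)
    (x : ι → (Quiver.Path i j →₀ K)) : concat y (∑ t ∈ s, x t) = ∑ t ∈ s, concat y (x t) := by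
  classical
  induction s using Finset.induction_on with
  | empty => simp
  | insert a s ha ih => rw [Finset.sum_insert ha, Finset.sum_insert ha, concat_add, ih]

open Classical in
/-- A path, as an element of the path algebra. -/
def ofPath {i j : V} (p : Quiver.Path i j) : PathAlgebra K V :=
  (Pi.single i (Pi.single j (Finsupp.single p 1)) : (i j : V) → (Quiver.Path i j →₀ K))

open Classical in
/-- The sum of all trivial paths. -/
instance : One (PathAlgebra K V) where
  one := fun i => Pi.single i (Finsupp.single Quiver.Path.nil 1)

theorem one_apply_self (i : V) :
    (1 : PathAlgebra K V) i i = Finsupp.single Quiver.Path.nil 1 := by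
  classical
  exact Pi.single_eq_same (M := fun j => (Quiver.Path i j →₀ K)) i _

theorem one_apply_of_ne {i j : V} (h : j ≠ i) : (1 : PathAlgebra K V) i j = 0 := by
  classical
  exact Pi.single_eq_of_ne (M := fun j => (Quiver.Path i j →₀ K)) h _

variable [Fintype V]

/-- The product is written like the composition of maps: `y * x` means first `x`, then `y`. -/
instance : Mul (PathAlgebra K V) where
  mul y x := fun i k => ∑ j, concat (y j k) (x i j)

theorem mul_apply (y x : PathAlgebra K V) (i k : V) :
    (y * x) i k = ∑ j, concat (y j k) (x i j) := rfl

protected theorem one_mul (x : PathAlgebra K V) : 1 * x = x := by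
  ext1 i k
  rw [mul_apply, Finset.sum_eq_single k]
  · rw [one_apply_self, nil_concat]
  · intro j _ hj
    rw [one_apply_of_ne (Ne.symm hj), zero_concat]
  · simp

protected theorem mul_one (x : PathAlgebra K V) : x * 1 = x := by
  ext1 i k
  rw [mul_apply, Finset.sum_eq_single i]
  · rw [one_apply_self, concat_nil]
  · intro j _ hj
    rw [one_apply_of_ne hj, concat_zero]
  · simp

instance : Ring (PathAlgebra K V) :=
  { (inferInstance : AddCommGroup (PathAlgebra K V)),
    (inferInstance : Mul (PathAlgebra K V)),
    (inferInstance : One (PathAlgebra K V)) with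
    left_distrib := fun x y z => by
      ext1 i k
      simp [mul_apply, concat_add, Finset.sum_add_distrib]
    right_distrib := fun x y z => by
      ext1 i k
      simp [mul_apply, add_concat, Finset.sum_add_distrib]
    zero_mul := fun x => by
      ext1 i k
      simp [mul_apply]
    mul_zero := fun x => by
      ext1 i k
      simp [mul_apply]
    mul_assoc := fun x y z => by
      ext1 i k
      simp only [mul_apply, concat_sum, sum_concat, concat_assoc]
      exact Finset.sum_comm
    one_mul := PathAlgebra.one_mul
    mul_one := PathAlgebra.mul_one }

instance : Algebra K (PathAlgebra K V) :=
  Algebra.ofModule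
    (fun c x y => by
      ext1 i k
      simp [mul_apply, smul_concat, Finset.smul_sum])
    (fun c x y => by
      ext1 i k
      simp [mul_apply, concat_smul, Finset.smul_sum])

theorem ofPath_mul_ofPath {i j k : V} (q : Quiver.Path j k) (p : Quiver.Path i j) :
    (ofPath q * ofPath p : PathAlgebra K V) = ofPath (p.comp q) := by
  classical
  ext1 a c
  rw [mul_apply, Finset.sum_eq_single j]
  · by_cases ha : a = i
    · subst ha
      by_cases hc : c = k
      · subst hc
        simp [ofPath, concat_single_single]
      · simp [ofPath, Pi.single_eq_of_ne hc]
    · simp [ofPath, Pi.single_eq_of_ne ha]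
  · intro b _ hb
    simp [ofPath, Pi.single_eq_of_ne hb]
  · simp

/-- `I` is an admissible ideal: `R ^ N ⊆ I ⊆ R ^ 2` for some `N`, where `R` is the ideal generated
by the arrows; note that `R ^ m` is the span of the paths of length at least `m`. -/
structure IsAdmissible (I : Ideal (PathAlgebra K V)) : Prop where
  two_le_length : ∀ x ∈ I, ∀ (i j : V) (p : Quiver.Path i j), p.length < 2 → x i j p = 0
  exists_pow_le : ∃ N : ℕ, ∀ (i j : V) (p : Quiver.Path i j), N ≤ p.length → ofPath p ∈ I

/-- The residue class of a path in `K Q / I`. -/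
def pathClass (I : Ideal (PathAlgebra K V)) [I.IsTwoSided] {i j : V} (p : Quiver.Path i j) :
    PathAlgebra K V ⧸ I :=
  Ideal.Quotient.mk I (ofPath p)

/-- The idempotent `e_i` of `K Q / I`, the residue class of the trivial path at `i`. -/
def vertexIdem (I : Ideal (PathAlgebra K V)) [I.IsTwoSided] (i : V) : PathAlgebra K V ⧸ I :=
  pathClass I (Quiver.Path.nil : Quiver.Path i i)

end PathAlgebra

end PathAlgebra

/-! ### Increasing and declining paths -/

/-- A path `(λ₀ → λ₁ → ⋯ → λᵣ)` with `λ₀ ≤ λ₁ ≤ ⋯ ≤ λᵣ`. -/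
def IsIncreasingPath {V : Type w} [PartialOrder V] [Quiver.{v} V] {a : V} :
    ∀ {b : V}, Quiver.Path a b → Prop
  | _, .nil => True
  | _, @Quiver.Path.cons _ _ _ b c p _ => IsIncreasingPath p ∧ b ≤ c

/-- A path `(μ₀ → μ₁ → ⋯ → μₘ)` with `μ₀ ≥ μ₁ ≥ ⋯ ≥ μₘ`. -/
def IsDecliningPath {V : Type w} [PartialOrder V] [Quiver.{v} V] {a : V} :
    ∀ {b : V}, Quiver.Path a b → Prop
  | _, .nil => True
  | _, @Quiver.Path.cons _ _ _ b c p _ => IsDecliningPath p ∧ c ≤ b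

/-! ### Modules over an algebra with chosen idempotents -/

section Modules

variable (K : Type u) [Field K] {A : Type v} [Ring A] [Algebra K A] {V : Type w} (e : V → A)

/-- `[M : S(k)] = dim_K M_k`, where `M_k = e_k M`. -/
def simpleMult (M : Type*) [AddCommGroup M] [Module A M] [Module K M] [IsScalarTower K A M]
    (k : V) : ℕ :=
  Module.finrank K (LinearMap.range (Algebra.lsmul K K M (e k)))

/-- The projective module `P(i) = A e_i`. -/
abbrev projModule (i : V) : Submodule A A := Submodule.span A {e i}

/-- The top `M / rad M` of a module, where `rad M` is the intersection of the maximal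
submodules. -/
abbrev moduleTop (A : Type*) [Ring A] (M : Type*) [AddCommGroup M] [Module A M] : Type _ :=
  M ⧸ Module.jacobson A M

/-- The socle of a module: the sum of all simple submodules. -/
def moduleSocle (A : Type*) [Ring A] (M : Type*) [AddCommGroup M] [Module A M] : Submodule A M :=
  sSup {N : Submodule A M | IsSimpleModule A N}

/-- The simple module `S(i)`, the top of `P(i)`. -/
abbrev simpleModule (i : V) : Type _ := moduleTop A (projModule e i)

/-- The `K`-dual `Hom_K(A, K)` of the right regular module. -/
def RegularDual (K : Type u) [Field K] (A : Type v) [Ring A] [Algebra K A] : Type (max u v) :=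
  Module.Dual K A

instance : AddCommGroup (RegularDual K A) := inferInstanceAs (AddCommGroup (Module.Dual K A))

instance : Module K (RegularDual K A) := inferInstanceAs (Module K (Module.Dual K A))

instance : FunLike (RegularDual K A) A K := inferInstanceAs (FunLike (Module.Dual K A) A K)

theorem RegularDual.ext {f g : RegularDual K A} (h : ∀ x : A, f x = g x) : f = g :=
  LinearMap.ext h

/-- The left `A`-action on `Hom_K(A, K)`: `(a • f) x = f (x a)`. -/
instance : SMul A (RegularDual K A) where
  smul a f := LinearMap.comp (M₂ := A) (f : Module.Dual K A) (LinearMap.mulRight K a)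

@[simp] theorem RegularDual.smul_apply (a : A) (f : RegularDual K A) (x : A) :
    (a • f) x = f (x * a) := rfl

@[simp] theorem RegularDual.add_apply (f g : RegularDual K A) (x : A) :
    (f + g) x = f x + g x := rfl

@[simp] theorem RegularDual.zero_apply (x : A) : (0 : RegularDual K A) x = 0 := rfl

theorem RegularDual.map_add (f : RegularDual K A) (x y : A) : f (x + y) = f x + f y :=
  LinearMap.map_add (f : Module.Dual K A) x y

theorem RegularDual.map_zero (f : RegularDual K A) : f 0 = 0 :=
  LinearMap.map_zero (f : Module.Dual K A)

theorem RegularDual.map_smul (f : RegularDual K A) (c : K) (x : A) : f (c • x) = c * f x :=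
  LinearMap.map_smul (f : Module.Dual K A) c x

instance : Module A (RegularDual K A) where
  one_smul f := RegularDual.ext K fun x => by simp
  mul_smul a b f := RegularDual.ext K fun x => by simp [mul_assoc]
  smul_zero a := RegularDual.ext K fun x => by simp
  smul_add a f g := RegularDual.ext K fun x => by simp
  add_smul a b f := RegularDual.ext K fun x => by simp [mul_add, RegularDual.map_add]
  zero_smul f := RegularDual.ext K fun x => by simp [RegularDual.map_zero]

/-- The injective module `I(i) = Hom_K(e_i A, K)`, realised as the set of linear forms on
`A = e_i A ⊕ (1 - e_i) A` which vanish on `(1 - e_i) A`. -/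
def injModule (i : V) : Submodule A (RegularDual K A) where
  carrier := {f | ∀ x : A, f (e i * x) = f x}
  add_mem' := fun hf hg x => by simp [hf x, hg x]
  zero_mem' := fun x => by simp
  smul_mem' := fun a f hf x => by
    simpa [mul_assoc] using hf (x * a)

variable [PartialOrder V]

/-- The smallest submodule `U` of `P(i)` such that `(P(i) / U)_k = 0` for all `k ≰ i`. -/
def standardKer (i : V) : Submodule A (projModule e i) :=
  sInf {U | ∀ k : V, ¬ k ≤ i → ∀ x : projModule e i, e k • x ∈ U}

/-- The standard module `Δ(i)`, the largest factor module of `P(i)` without composition factors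
`S(k)`, `k ≰ i`. -/
abbrev standardModule (i : V) : Type _ := projModule e i ⧸ standardKer e i

/-- The costandard module `∇(i)`, the largest submodule of `I(i)` without composition factors
`S(k)`, `k ≰ i`. -/
def costandardModule (i : V) : Submodule A (RegularDual K A) :=
  sSup {N | N ≤ injModule K e i ∧ ∀ k : V, ¬ k ≤ i → ∀ f ∈ N, e k • f = 0}

/-- `M` has a filtration `0 = F 0 ⊆ F 1 ⊆ ⋯ ⊆ F r = M` with `F (t + 1) / F t ≅ Δ(l_t)`, where
`l = [l_0, …, l_{r - 1}]`. -/
def HasStandardFiltration (M : Type*) [AddCommGroup M] [Module A M] (l : List V) : Prop :=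
  ∃ F : ℕ → Submodule A M, F 0 = ⊥ ∧ F l.length = ⊤ ∧
    ∀ (t : ℕ) (ht : t < l.length), F t ≤ F (t + 1) ∧
      Nonempty ((F (t + 1) ⧸ (F t).submoduleOf (F (t + 1))) ≃ₗ[A] standardModule e l[t])

/-- `M` is `Δ`-good. -/
def IsStandardGood (M : Type*) [AddCommGroup M] [Module A M] : Prop :=
  ∃ l : List V, HasStandardFiltration e M l

open Classical in
/-- `(M : Δ(i))`, the number of subquotients `Δ(i)` in some `Δ`-good filtration of a `Δ`-good
module `M`. -/
def standardMult (M : Type*) [AddCommGroup M] [Module A M] (i : V) : ℕ :=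
  if h : IsStandardGood e M then h.choose.count i else 0

/-- `A` is quasi-hereditary with respect to the partial order on the vertices. -/
structure IsQuasiHereditary : Prop where
  standard_self : ∀ i : V, simpleMult K e (standardModule e i) i = 1
  proj_good : ∀ i : V, IsStandardGood e (projModule e i)
  proj_mult_eq_zero : ∀ i k : V, ¬ i ≤ k → standardMult e (projModule e i) k = 0
  proj_mult_self : ∀ i : V, standardMult e (projModule e i) i = 1

/-- `A` is 1-quasi-hereditary; `o` and `m` are the smallest and the largest vertex. -/
structure IsOneQuasiHereditary : Prop extends IsQuasiHereditary K e where
  standard_mult : ∀ i j : V, j ≤ i → simpleMult K e (standardModule e i) j = 1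
  proj_mult : ∀ i j : V, j ≤ i → standardMult e (projModule e j) i = 1
  exists_min_max : ∃ o m : V, (∀ i : V, o ≤ i ∧ i ≤ m) ∧
    (∀ i : V,
      Nonempty (moduleSocle A (projModule e i) ≃ₗ[A] simpleModule e o) ∧
      Nonempty (moduleTop A (injModule K e i) ≃ₗ[A] simpleModule e o)) ∧
    (∀ i : V,
      (∃ f : standardModule e i →ₗ[A] standardModule e m, Function.Injective f) ∧
      (∃ g : costandardModule K e m →ₗ[A] costandardModule K e i, Function.Surjective g))

end Modules

/-! ### Submodules of `P(j)` generated by a path -/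

section PathModules

variable {K : Type u} [Field K] {V : Type w} [Fintype V] [Quiver.{v} V]

open PathAlgebra in
theorem pathClass_mem_projModule (I : Ideal (PathAlgebra K V)) [I.IsTwoSided] {j k : V}
    (p : Quiver.Path j k) : pathClass I p ∈ projModule (vertexIdem I) j := by
  refine Submodule.mem_span_singleton.mpr ⟨pathClass I p, ?_⟩
  simp only [vertexIdem, pathClass, smul_eq_mul]
  rw [← map_mul, ofPath_mul_ofPath, Quiver.Path.nil_comp]

/-- The module `⟨p⟩ = A p` generated by a path `p` starting at `j`, as a submodule of `P(j)`. -/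
def pathModule (I : Ideal (PathAlgebra K V)) [I.IsTwoSided] {j k : V} (p : Quiver.Path j k) :
    Submodule (PathAlgebra K V ⧸ I) (projModule (PathAlgebra.vertexIdem I) j) :=
  Submodule.span _ {⟨PathAlgebra.pathClass I p, pathClass_mem_projModule I p⟩}

end PathModules

end

/-! An endomorphism of `P(j) = A e_j` is right multiplication by an element of `e_j A e_j`. For the
product `b a`, with `a` the class of an increasing path `j → i` and `b` that of a declining path `i
→ k`, it therefore suffices that every `x` in `e_j A e_j` admits some `z` with `b a x = z b a`. This
follows by moving `x` across in two steps, `a x = y a` and `b y = z b`, from `e_i A e_i a = e_i A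
e_j` and `e_k A e_k b = e_k A e_i`.

Two facts about `A` suffice (`HasMinimalSocles`). All `A e_i` and `e_i A` have simple socle at the
smallest vertex `o`, and `dim e_k A e_j` is the number of common upper bounds of `k` and `j`. The
dimension is read off a standard filtration of `P(j)`, in which each `Δ(i)` with `i ≥ j` occurs once
and contributes 1 if `k ≤ i`.

The order is translated into injectivity. By the simple socles, right multiplication by a product is
injective iff it is for both factors (`rightInj_mul_iff`). By dimensions, an injective right
multiplication by an element of `e_i A e_j` forces `j ≤ i` and gives `e_i A e_i a = e_i A e_j`.
Conversely, for `j ≤ i` an injective element exists, and hence an injective path. Its arrows ascend,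
so increasing paths exist. An arrow `b → c` with `b < c` factors through an injective path `b → c`,
and admissibility forces that path to be the arrow itself. As there are no loops, every increasing
path is injective. Declining paths are dual, by passage to the opposite algebra.

The equality `e_k A e_k b = e_k A e_i` is not a dimension count. For `k = o` it is dual to the
injectivity of `y ↦ b y`, under a nondegenerate pairing of `e_o A e_i` with `e_i A e_o`
(`mul_surjective_of_leftInj_bot`). The general case reduces to this one by left multiplication with
an injective element of `e_o A e_k`. -/

noncomputable section

/-! ### Peirce components and injective multiplications -/

section Peirce

variable (K : Type u) [Field K] {A : Type v} [Ring A] [Algebra K A] {V : Type w} (e : V → A)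

/-- The Peirce component `e_k A e_j`. -/
def peirceSpace (k j : V) : Submodule K A where
  carrier := {x | e k * x = x ∧ x * e j = x}
  add_mem' := fun hx hy => ⟨by rw [mul_add, hx.1, hy.1], by rw [add_mul, hx.2, hy.2]⟩
  zero_mem' := by simp
  smul_mem' := fun c x hx => ⟨by rw [mul_smul_comm, hx.1], by rw [smul_mul_assoc, hx.2]⟩

variable {K e}

theorem mem_peirce {k j : V} {x : A} : x ∈ peirceSpace K e k j ↔ e k * x = x ∧ x * e j = x := Iff.rfl

theorem mul_mem_peirce {l j : V} {x y : A} (hy : e l * y = y) (hx : x * e j = x) :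
    y * x ∈ peirceSpace K e l j :=
  ⟨by rw [← mul_assoc, hy], by rw [mul_assoc, hx]⟩

/-- Right multiplication by `x` is injective on `A e_c`. -/
def RightInj (e : V → A) (c : V) (x : A) : Prop := ∀ y, y * e c = y → y * x = 0 → y = 0

/-- Left multiplication by `x` is injective on `e_a A`. -/
def LeftInj (e : V → A) (a : V) (x : A) : Prop := ∀ y, e a * y = y → x * y = 0 → y = 0

open MulOpposite in
theorem mem_peirce_op {k j : V} {x : A} :
    op x ∈ peirceSpace K (fun i => op (e i)) j k ↔ x ∈ peirceSpace K e k j := by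
  simp only [mem_peirce, ← op_mul, op_inj]
  exact and_comm

open MulOpposite in
theorem rightInj_op {c : V} {x : A} :
    RightInj (fun i => op (e i)) c (op x) ↔ LeftInj e c x := by
  constructor
  · intro h y h1 h2
    have := h (op y) (by rw [← op_mul, h1]) (by rw [← op_mul, h2, op_zero])
    simpa using this
  · intro h y h1 h2
    induction y using MulOpposite.rec' with
    | h y =>
      rw [← op_mul, op_inj] at h1
      rw [← op_mul, op_eq_zero_iff] at h2
      rw [h y h1 h2, op_zero]

/-- Right multiplication by `a`, from `e_k A e_i` to `e_k A e_j`. -/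
def mulRightMap (k : V) {i j : V} {a : A} (ha : a ∈ peirceSpace K e i j) :
    peirceSpace K e k i →ₗ[K] peirceSpace K e k j :=
  (LinearMap.mulRight K a).restrict fun _ hx => ⟨by
    rw [LinearMap.mulRight_apply, ← mul_assoc, hx.1], by
    rw [LinearMap.mulRight_apply, mul_assoc, ha.2]⟩

theorem mulRightMap_injective (k : V) {i j : V} {a : A} (ha : a ∈ peirceSpace K e i j)
    (hinj : RightInj e i a) : Function.Injective (mulRightMap k ha) := by
  rw [injective_iff_map_eq_zero]
  intro x hx
  exact Subtype.ext (hinj x x.2.2 (congrArg Subtype.val hx))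

variable [Fintype V] [PartialOrder V]

open Classical in
/-- The number of common upper bounds of two vertices. -/
def upperCount (k j : V) : ℕ := (Finset.univ.filter fun l : V => j ≤ l ∧ k ≤ l).card

theorem upperCount_comm (k j : V) : upperCount k j = upperCount j k := by
  unfold upperCount
  congr 1
  ext l
  simp only [Finset.mem_filter, and_comm]

theorem upperCount_of_le {k j : V} (h : j ≤ k) : upperCount k j = upperCount k k := by
  classical
  unfold upperCount
  congr 1
  ext l
  simp only [Finset.mem_filter, Finset.mem_univ, true_and, and_self]
  exact ⟨fun hl => hl.2, fun hl => ⟨h.trans hl, hl⟩⟩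

theorem le_of_upperCount_le {k j : V} (h : upperCount k k ≤ upperCount k j) : j ≤ k := by
  classical
  unfold upperCount at h
  have hs : (Finset.univ.filter fun l : V => j ≤ l ∧ k ≤ l) ⊆
      (Finset.univ.filter fun l : V => k ≤ l ∧ k ≤ l) := fun l hl => by
    simp only [Finset.mem_filter, Finset.mem_univ, true_and] at hl ⊢
    exact ⟨hl.2, hl.2⟩
  have hk : k ∈ (Finset.univ.filter fun l : V => j ≤ l ∧ k ≤ l) := by
    rw [Finset.eq_of_subset_of_card_le hs h]
    simp
  simp only [Finset.mem_filter] at hk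
  exact hk.2.1

/-! ### Consequences of simple socles and known dimensions -/

variable (K e) in
/-- Each `A e_i` and each `e_i A` has a simple socle at the smallest vertex `o`, and
`dim e_k A e_j` is the number of common upper bounds of `k` and `j`. -/
structure HasMinimalSocles (o : V) : Prop where
  idem : ∀ i, e i * e i = e i
  bot_le : ∀ i, o ≤ i
  left_socle : ∀ i, ∃ t ∈ peirceSpace K e o i, t ≠ 0 ∧ ∀ x, x * e i = x → x ≠ 0 → ∃ z, z * x = t
  right_socle : ∀ i, ∃ s ∈ peirceSpace K e i o, s ≠ 0 ∧ ∀ x, e i * x = x → x ≠ 0 → ∃ z, x * z = s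
  rank_peirce : ∀ k j, Module.rank K (peirceSpace K e k j) = upperCount k j

namespace HasMinimalSocles

variable {o : V}

open MulOpposite in
-- The axioms are left-right symmetric because `upperCount` is. Statements on left multiplication
-- thus follow from those on right multiplication.
theorem opposite (h : HasMinimalSocles K e o) :
    HasMinimalSocles K (fun i => op (e i)) o where
  idem i := by rw [← op_mul, h.idem]
  bot_le := h.bot_le
  left_socle i := by
    obtain ⟨s, hs, h0, H⟩ := h.right_socle i
    refine ⟨op s, mem_peirce_op.2 hs, by simpa using h0, fun x hx hx0 => ?_⟩
    obtain ⟨z, hz⟩ := H (unop x) (by simpa using congrArg unop hx) (by simpa using hx0)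
    exact ⟨op z, by rw [← hz, op_mul, op_unop]⟩
  right_socle i := by
    obtain ⟨s, hs, h0, H⟩ := h.left_socle i
    refine ⟨op s, mem_peirce_op.2 hs, by simpa using h0, fun x hx hx0 => ?_⟩
    obtain ⟨z, hz⟩ := H (unop x) (by simpa using congrArg unop hx) (by simpa using hx0)
    exact ⟨op z, by rw [← hz, op_mul, op_unop]⟩
  rank_peirce k j := by
    rw [upperCount_comm, ← h.rank_peirce j k]
    have : peirceSpace K (fun i => op (e i)) k j =
        (peirceSpace K e j k).map (opLinearEquiv K : A ≃ₗ[K] Aᵐᵒᵖ).toLinearMap := by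
      ext x
      induction x using MulOpposite.rec' with
      | h x =>
        rw [mem_peirce_op, Submodule.mem_map]
        exact ⟨fun hx => ⟨x, hx, rfl⟩, fun ⟨y, hy, hxy⟩ => op_injective hxy ▸ hy⟩
    rw [this]
    exact ((opLinearEquiv K : A ≃ₗ[K] Aᵐᵒᵖ).submoduleMap (peirceSpace K e j k)).symm.rank_eq

theorem finite (h : HasMinimalSocles K e o) (k j : V) : Module.Finite K (peirceSpace K e k j) :=
  Module.rank_lt_aleph0_iff.1 (by rw [h.rank_peirce]; exact Cardinal.natCast_lt_aleph0)

theorem finrank (h : HasMinimalSocles K e o) (k j : V) :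
    Module.finrank K (peirceSpace K e k j) = upperCount k j :=
  Module.finrank_eq_of_rank_eq (h.rank_peirce k j)

theorem idem_ne_zero (h : HasMinimalSocles K e o) (i : V) : e i ≠ 0 := by
  obtain ⟨t, ht, h0, -⟩ := h.left_socle i
  intro hi
  exact h0 (by rw [← ht.2, hi, mul_zero])

/-- The kernel of right multiplication by `x` on `A e_c` is a left submodule, so if nonzero it
contains the socle element `t`. -/
theorem rightInj_of_ne_zero (h : HasMinimalSocles K e o) (c : V) :
    ∃ t ∈ peirceSpace K e o c, t ≠ 0 ∧ ∀ x, t * x ≠ 0 → RightInj e c x := by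
  obtain ⟨t, ht, h0, H⟩ := h.left_socle c
  refine ⟨t, ht, h0, fun x hx y hy hyx => ?_⟩
  by_contra hy0
  obtain ⟨z, rfl⟩ := H y hy hy0
  exact hx (by rw [mul_assoc, hyx, mul_zero])

/-- The embedding of `e_i A e_i` into `e_i A e_j` bounds the number of vertices above `i` by the
number above both `i` and `j`. Hence all vertices above `i`, including `i`, lie above `j`. -/
theorem le_of_rightInj (h : HasMinimalSocles K e o) {i j : V} {a : A} (ha : a ∈ peirceSpace K e i j)
    (hinj : RightInj e i a) : j ≤ i := by
  have := h.finite i j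
  have := LinearMap.finrank_le_finrank_of_injective (mulRightMap_injective i ha hinj)
  rw [h.finrank, h.finrank] at this
  exact le_of_upperCount_le this

theorem exists_mul_eq (h : HasMinimalSocles K e o) {k i j : V} {a : A}
    (ha : a ∈ peirceSpace K e i j) (hinj : RightInj e i a) (hk : upperCount k i = upperCount k j)
    {x : A} (hx : x ∈ peirceSpace K e k j) : ∃ y ∈ peirceSpace K e k i, y * a = x := by
  have := h.finite k i
  have := h.finite k j
  have hs := (LinearMap.injective_iff_surjective_of_finrank_eq_finrank
    (by rw [h.finrank, h.finrank, hk])).1 (mulRightMap_injective k ha hinj)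
  obtain ⟨y, hy⟩ := hs ⟨x, hx⟩
  exact ⟨y, y.2, congrArg Subtype.val hy⟩

/-- The left socle element `t` of `A e_i` is a nonzero element of `e_o A`, so some multiple `t z` is
the right socle element of `e_o A`. In particular it is nonzero. -/
theorem exists_rightInj_bot (h : HasMinimalSocles K e o) (i : V) :
    ∃ a ∈ peirceSpace K e i o, RightInj e i a := by
  obtain ⟨t, ht, h0, H⟩ := h.rightInj_of_ne_zero i
  obtain ⟨s, hs, hs0, H'⟩ := h.right_socle o
  obtain ⟨z, hz⟩ := H' t ht.1 h0
  -- Cutting `z` down to `e_i z e_o` does not change `t z = s`, since `t e_i = t` and `s e_o = s`.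
  refine ⟨e i * z * e o, ⟨by rw [← mul_assoc, ← mul_assoc, h.idem],
    by rw [mul_assoc, h.idem]⟩, H _ ?_⟩
  rw [← mul_assoc, ← mul_assoc, ht.2, hz, hs.2]
  exact hs0

/-- For injective `c ∈ e_j A e_o` and `d ∈ e_i A e_o`, dimensions allow `d = a c`, and `t a = 0`
would give `t d = 0`. The socle element `t` stays in the conclusion because the condition `t a ≠ 0`
is linear in `a`, so it passes to some path in an expansion of `a`. -/
theorem exists_rightInj (h : HasMinimalSocles K e o) {i j : V} (hij : j ≤ i) :
    ∃ a ∈ peirceSpace K e i j, ∃ t ∈ peirceSpace K e o i, t * a ≠ 0 ∧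
      ∀ x, t * x ≠ 0 → RightInj e i x := by
  obtain ⟨c, hc, hci⟩ := h.exists_rightInj_bot j
  obtain ⟨d, hd, hdi⟩ := h.exists_rightInj_bot i
  obtain ⟨t, ht, h0, H⟩ := h.rightInj_of_ne_zero i
  obtain ⟨a, ha, rfl⟩ := h.exists_mul_eq (k := i) hc hci
    (by rw [upperCount_of_le hij, upperCount_of_le (h.bot_le i)]) hd
  exact ⟨a, ha, t, ht, fun hta => h0 (hdi t ht.2 (by rw [← mul_assoc, hta, zero_mul])), H⟩

theorem rightInj_mul_iff (h : HasMinimalSocles K e o) {b c : V} {x y : A}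
    (hy : y ∈ peirceSpace K e c b) :
    RightInj e c (y * x) ↔ RightInj e b x ∧ RightInj e c y := by
  constructor
  · intro H
    refine ⟨fun z hz hzx => ?_, fun z hz hzy => H z hz (by rw [← mul_assoc, hzy, zero_mul])⟩
    by_contra hz0
    obtain ⟨t, ht, h0, Ht⟩ := h.left_socle b
    obtain ⟨z', hz'⟩ := Ht z hz hz0
    have hy0 : y ≠ 0 := fun hy0 => h.idem_ne_zero c
      (H (e c) (h.idem c) (by rw [hy0, zero_mul, mul_zero]))
    obtain ⟨w, hw⟩ := Ht y hy.2 hy0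
    -- If `z x = 0` with `z ≠ 0`, the socle element `t` is a multiple of both `z` and `y`. Then `w
    -- e_c` is killed by `y x`, since `w y x = t x = z' z x = 0`.
    have : w * e c = 0 := H (w * e c) (by rw [mul_assoc, h.idem]) (by
      rw [mul_assoc, ← mul_assoc (e c), hy.1, ← mul_assoc, hw, ← hz', mul_assoc, hzx, mul_zero])
    apply h0
    rw [← hw, ← hy.1, ← mul_assoc, this, zero_mul]
  · rintro ⟨H1, H2⟩ z hz hzx
    refine H2 z hz (H1 _ (by rw [mul_assoc, hy.2]) (by rw [mul_assoc, hzx]))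

open MulOpposite

theorem le_of_leftInj (h : HasMinimalSocles K e o) {i k : V} {b : A} (hb : b ∈ peirceSpace K e k i)
    (hinj : LeftInj e i b) : k ≤ i :=
  h.opposite.le_of_rightInj (mem_peirce_op.2 hb) (rightInj_op.2 hinj)

theorem exists_mul_eq_left (h : HasMinimalSocles K e o) {k i j : V} {b : A}
    (hb : b ∈ peirceSpace K e k i) (hinj : LeftInj e i b) (hk : upperCount j i = upperCount j k)
    {x : A} (hx : x ∈ peirceSpace K e k j) : ∃ y ∈ peirceSpace K e i j, b * y = x := by
  obtain ⟨y, hy, hyx⟩ := h.opposite.exists_mul_eq (mem_peirce_op.2 hb) (rightInj_op.2 hinj) hk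
    (mem_peirce_op.2 hx)
  refine ⟨unop y, mem_peirce_op.1 (by simpa using hy), ?_⟩
  simpa using congrArg unop hyx

theorem exists_leftInj (h : HasMinimalSocles K e o) {i k : V} (hki : k ≤ i) :
    ∃ b ∈ peirceSpace K e k i, ∃ s ∈ peirceSpace K e i o, b * s ≠ 0 ∧
      ∀ x, x * s ≠ 0 → LeftInj e i x := by
  obtain ⟨a, ha, t, ht, h0, H⟩ := h.opposite.exists_rightInj hki
  refine ⟨unop a, mem_peirce_op.1 (by simpa using ha), unop t,
    mem_peirce_op.1 (by simpa using ht), ?_, fun x hx => rightInj_op.1 (H _ ?_)⟩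
  · rwa [← unop_mul, Ne, unop_eq_zero_iff]
  · intro h'
    exact hx (by simpa using congrArg unop h')

theorem leftInj_mul_iff (h : HasMinimalSocles K e o) {a b : V} {x y : A}
    (hx : x ∈ peirceSpace K e b a) :
    LeftInj e a (y * x) ↔ LeftInj e b y ∧ LeftInj e a x := by
  rw [← rightInj_op, ← rightInj_op, ← rightInj_op, op_mul]
  exact h.opposite.rightInj_mul_iff (mem_peirce_op.2 hx)

/-! ### Duality and the moving of elements across a product -/

/-- The pairing `(x, y) ↦ φ (x b y)` between two subspaces. -/
def pairing (φ : A →ₗ[K] K) (b : A) (P Q : Submodule K A) : P →ₗ[K] Q →ₗ[K] K :=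
  (((LinearMap.mul K A).compl₂ (LinearMap.mulLeft K b)).compr₂ φ).domRestrict₁₂ P Q

theorem pairing_apply (φ : A →ₗ[K] K) (b : A) (P Q : Submodule K A) (x : P) (y : Q) :
    pairing φ b P Q x y = φ (x * (b * y)) := rfl

/-- A linear form for which `e_o A e_k × e_k A e_o → K`, `(x, y) ↦ φ (x y)` is nondegenerate. -/
theorem exists_nondegenerate_form (h : HasMinimalSocles K e o) : ∃ φ : A →ₗ[K] K, ∀ k,
    (∀ x ∈ peirceSpace K e o k, (∀ y ∈ peirceSpace K e k o, φ (x * y) = 0) → x = 0) ∧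
    (∀ y ∈ peirceSpace K e k o, (∀ x ∈ peirceSpace K e o k, φ (x * y) = 0) → y = 0) := by
  obtain ⟨s, hs, hs0, H⟩ := h.right_socle o
  -- It is enough that `φ` does not vanish on the socle element `s` of `e_o A`: every nonzero `x` in
  -- `e_o A e_k` has a multiple `x z = s`. Nondegeneracy on the other side follows from equal
  -- dimensions.
  obtain ⟨φ, hφ⟩ := Module.Projective.exists_dual_ne_zero K hs0
  refine ⟨φ, fun k => ?_⟩
  have hl : ∀ x ∈ peirceSpace K e o k, (∀ y ∈ peirceSpace K e k o, φ (x * y) = 0) → x = 0 := by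
    intro x hx hxy
    by_contra hx0
    obtain ⟨z, hz⟩ := H x hx.1 hx0
    refine hφ ?_
    have := hxy (e k * z * e o) (mul_mem_peirce (by rw [← mul_assoc, h.idem]) (h.idem o))
    rwa [← mul_assoc, ← mul_assoc, hx.2, hz, hs.2] at this
  refine ⟨hl, fun y hy hyx => ?_⟩
  have := h.finite o k
  have := h.finite k o
  have hinj : Function.Injective (pairing φ 1 (peirceSpace K e o k) (peirceSpace K e k o)) := by
    rw [injective_iff_map_eq_zero]
    intro x hx
    refine Subtype.ext (hl x x.2 fun y hy => ?_)
    have := LinearMap.congr_fun hx ⟨y, hy⟩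
    rwa [pairing_apply, one_mul] at this
  have hsurj := (LinearMap.injective_iff_surjective_of_finrank_eq_finrank (by
    rw [Subspace.dual_finrank_eq, h.finrank, h.finrank, upperCount_comm])).1 hinj
  have hinj' := LinearMap.flip_injective_iff₂.2 hsurj
  have h0 : (⟨y, hy⟩ : peirceSpace K e k o) = 0 := by
    refine hinj' ?_
    rw [map_zero]
    ext x
    rw [LinearMap.flip_apply, pairing_apply, one_mul]
    exact hyx x x.2
  exact congrArg Subtype.val h0

theorem mul_surjective_of_leftInj_bot (h : HasMinimalSocles K e o) {i : V} {b : A}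
    (hb : b ∈ peirceSpace K e o i) (hinj : LeftInj e i b) {u : A}
    (hu : u ∈ peirceSpace K e o i) : ∃ z ∈ peirceSpace K e o o, z * b = u := by
  obtain ⟨φ, hφ⟩ := h.exists_nondegenerate_form
  have := h.finite o o
  have := h.finite i o
  have hsurj : Function.Surjective
      (pairing φ b (peirceSpace K e o o) (peirceSpace K e i o)) := by
    -- Injectivity of `y ↦ b y` makes `(x, y) ↦ φ (x b y)` nondegenerate in `y`. So every linear
    -- form on `e_i A e_o`, in particular `φ (u ·)`, has the form `φ (z b ·)`.
    rw [← LinearMap.flip_injective_iff₂, injective_iff_map_eq_zero]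
    intro y hy
    refine Subtype.ext (hinj y y.2.1 ((hφ o).2 _ (mul_mem_peirce hb.1 y.2.2) ?_))
    intro x hx
    exact LinearMap.congr_fun hy ⟨x, hx⟩
  obtain ⟨z, hz⟩ := hsurj (pairing φ 1 (peirceSpace K e o i) (peirceSpace K e i o) ⟨u, hu⟩)
  refine ⟨z, z.2, sub_eq_zero.1 ((hφ i).1 _
    (sub_mem (mul_mem_peirce z.2.1 hb.2) hu) fun y hy => ?_)⟩
  have := LinearMap.congr_fun hz ⟨y, hy⟩
  rw [pairing_apply, pairing_apply, one_mul, ← mul_assoc] at this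
  rw [sub_mul, map_sub, this, sub_self]

/-- With `c ∈ e_o A e_k` left injective, the case of `o` applied to `c b` gives `c u = β c b`. Since
`c e_k A e_k = e_o A e_k` by dimensions, `β c = c z`, and cancelling `c` leaves `u = z b`. -/
theorem mul_surjective_of_leftInj (h : HasMinimalSocles K e o) {k i : V} {b : A}
    (hb : b ∈ peirceSpace K e k i) (hinj : LeftInj e i b) {u : A}
    (hu : u ∈ peirceSpace K e k i) : ∃ z ∈ peirceSpace K e k k, z * b = u := by
  obtain ⟨c, hc, s, hs, hcs, H⟩ := h.exists_leftInj (h.bot_le k)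
  have hcinj := H c hcs
  obtain ⟨β, hβ, hβu⟩ := h.mul_surjective_of_leftInj_bot (mul_mem_peirce hc.1 hb.2)
    ((h.leftInj_mul_iff hb).2 ⟨hcinj, hinj⟩) (mul_mem_peirce hc.1 hu.2)
  obtain ⟨z, hz, hzc⟩ := h.exists_mul_eq_left (j := k) hc hcinj
    (by rw [upperCount_comm k o, upperCount_of_le (h.bot_le k) |>.symm, upperCount_comm])
    (mul_mem_peirce hβ.1 hc.2)
  refine ⟨z, hz, sub_eq_zero.1 (hcinj _ (sub_mem (mul_mem_peirce hz.1 hb.2) hu).1 ?_)⟩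
  rw [mul_sub, ← mul_assoc, hzc, mul_assoc, hβu, sub_self]

/-- If `a ∈ e_i A e_j` is right injective and `b ∈ e_k A e_i` is left injective, then `A b a` is
stable under right multiplication by `e_j A e_j`. -/
theorem exists_mul_eq_mul (h : HasMinimalSocles K e o) {k i j : V} (hji : j ≤ i) {a b : A}
    (ha : a ∈ peirceSpace K e i j) (hai : RightInj e i a)
    (hb : b ∈ peirceSpace K e k i) (hbi : LeftInj e i b) {x : A} (hx : x * e j = x) :
    ∃ z, z * (b * a) = b * a * x := by
  obtain ⟨y, hy, hya⟩ := h.exists_mul_eq (k := i) ha hai (upperCount_of_le hji).symm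
    (mul_mem_peirce ha.1 hx)
  obtain ⟨z, hz, hzb⟩ := h.mul_surjective_of_leftInj hb hbi (mul_mem_peirce hb.1 hy.2)
  exact ⟨z, by rw [← mul_assoc, hzb, mul_assoc, hya, mul_assoc]⟩

end HasMinimalSocles

end Peirce

end

/-! ### Dimensions of Peirce components from standard filtrations -/

noncomputable section

section Filtration

variable {K : Type u} [Field K] {A : Type v} [Ring A] [Algebra K A] {V : Type w} {e : V → A}

/-- The subspace `a M` of a module `M`. -/
abbrev smulRange (K : Type u) [Field K] {A : Type v} [Ring A] [Algebra K A] (a : A) (M : Type*)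
    [AddCommGroup M] [Module A M] [Module K M] [IsScalarTower K A M] : Submodule K M :=
  LinearMap.range (Algebra.lsmul K K M a)

/-- For an idempotent `a` the functor `M ↦ a M` is exact. Cardinal ranks are used because
finite-dimensionality of `A` is itself deduced from this count. -/
theorem rank_smulRange_of_exact {a : A} (ha : a * a = a) {M₁ M₂ M₃ : Type v}
    [AddCommGroup M₁] [Module A M₁] [Module K M₁] [IsScalarTower K A M₁]
    [AddCommGroup M₂] [Module A M₂] [Module K M₂] [IsScalarTower K A M₂]
    [AddCommGroup M₃] [Module A M₃] [Module K M₃] [IsScalarTower K A M₃]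
    (f : M₁ →ₗ[A] M₂) (hf : Function.Injective f) (g : M₂ →ₗ[A] M₃) (hg : Function.Surjective g)
    (hfg : LinearMap.range f = LinearMap.ker g) :
    Module.rank K (smulRange K a M₂) =
      Module.rank K (smulRange K a M₃) + Module.rank K (smulRange K a M₁) := by
  set G := (g.restrictScalars K).domRestrict (smulRange K a M₂) with hG
  have hrange : LinearMap.range G = smulRange K a M₃ := by
    ext y
    constructor
    · rintro ⟨⟨_, x, rfl⟩, rfl⟩
      exact ⟨g x, by simp [hG]⟩
    · rintro ⟨y, rfl⟩
      obtain ⟨x, rfl⟩ := hg y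
      exact ⟨⟨a • x, x, rfl⟩, by simp [hG]⟩
  have hker : (LinearMap.ker G).map (smulRange K a M₂).subtype =
      (smulRange K a M₁).map (f.restrictScalars K) := by
    ext y
    constructor
    · rintro ⟨⟨_, x, rfl⟩, hx, rfl⟩
      have hx' : a • x ∈ LinearMap.ker g := hx
      rw [← hfg] at hx'
      obtain ⟨z, hz⟩ := hx'
      refine ⟨a • z, ⟨z, rfl⟩, ?_⟩
      simp [hz, smul_smul, ha]
    · rintro ⟨_, ⟨z, rfl⟩, rfl⟩
      have hz : g (a • f z) = 0 := by
        rw [← map_smul]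
        exact LinearMap.mem_ker.1 (hfg ▸ LinearMap.mem_range_self f (a • z))
      exact ⟨⟨a • f z, f z, rfl⟩, hz, by simp⟩
  rw [← LinearMap.rank_range_add_rank_ker G, hrange]
  congr 1
  rw [((LinearMap.ker G).equivMapOfInjective _ (Submodule.injective_subtype _)).rank_eq, hker]
  exact ((smulRange K a M₁).equivMapOfInjective (f.restrictScalars K) hf).symm.rank_eq

theorem rank_smulRange_of_subsingleton (a : A) (M : Type v) [AddCommGroup M] [Module A M]
    [Module K M] [IsScalarTower K A M] [Subsingleton M] :
    Module.rank K (smulRange K a M) = 0 :=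
  rank_subsingleton' K _

theorem rank_smulRange_congr {a : A} (ha : a * a = a) {M N : Type v}
    [AddCommGroup M] [Module A M] [Module K M] [IsScalarTower K A M]
    [AddCommGroup N] [Module A N] [Module K N] [IsScalarTower K A N] (f : M ≃ₗ[A] N) :
    Module.rank K (smulRange K a M) = Module.rank K (smulRange K a N) := by
  -- An isomorphism is treated as a short exact sequence with zero third term.
  have := rank_smulRange_of_exact (K := K) ha f.symm.toLinearMap f.symm.injective
    (0 : M →ₗ[A] PUnit.{v + 1}) (fun x => ⟨0, Subsingleton.elim _ _⟩) (by simp)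
  rw [this, rank_smulRange_of_subsingleton, zero_add]

theorem mem_projModule (hidem : ∀ i, e i * e i = e i) {j : V} {x : A} :
    x ∈ projModule e j ↔ x * e j = x := by
  rw [Submodule.mem_span_singleton]
  constructor
  · rintro ⟨a, rfl⟩
    rw [smul_eq_mul, mul_assoc, hidem]
  · intro h
    exact ⟨x, h⟩

variable [PartialOrder V]

theorem rank_smulRange_of_filtration {a : A} (ha : a * a = a) {M : Type v} [AddCommGroup M]
    [Module A M] [Module K M] [IsScalarTower K A M] {l : List V}
    (h : HasStandardFiltration e M l) :
    Module.rank K (smulRange K a M) =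
      (l.map fun i => Module.rank K (smulRange K a (standardModule e i))).sum := by
  obtain ⟨F, h0, h1, hF⟩ := h
  have key : ∀ t ≤ l.length, Module.rank K (smulRange K a (F t)) =
      ((l.take t).map fun i => Module.rank K (smulRange K a (standardModule e i))).sum := by
    intro t
    induction t with
    | zero =>
      intro _
      have : Subsingleton (F 0) := by rw [h0]; infer_instance
      rw [rank_smulRange_of_subsingleton]
      simp
    | succ t ih =>
      intro ht
      obtain ⟨hle, ⟨φ⟩⟩ := hF t ht
      have := rank_smulRange_of_exact (K := K) ha (Submodule.inclusion hle)
        (Submodule.inclusion_injective hle) (Submodule.mkQ ((F t).submoduleOf (F (t + 1))))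
        (Submodule.mkQ_surjective _) (by
          rw [Submodule.ker_mkQ, Submodule.range_inclusion]; rfl)
      rw [this, rank_smulRange_congr ha φ, ih (by omega), List.take_succ_eq_append_getElem ht,
        List.map_append, List.sum_append, add_comm]
      simp
  rw [← rank_smulRange_congr ha (Submodule.topEquiv : (⊤ : Submodule A M) ≃ₗ[A] M), ← h1,
    key _ le_rfl, List.take_length]

theorem smul_standardModule_eq_zero {i k : V} (hki : ¬ k ≤ i) (x : standardModule e i) :
    e k • x = 0 := by
  obtain ⟨x, rfl⟩ := Submodule.mkQ_surjective _ x
  rw [← map_smul, Submodule.mkQ_apply, Submodule.Quotient.mk_eq_zero]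
  exact Submodule.mem_sInf.2 fun U hU => hU k hki x

open Classical in
theorem rank_smulRange_standardModule (h : IsOneQuasiHereditary K e) (i k : V) :
    Module.rank K (smulRange K (e k) (standardModule e i)) = if k ≤ i then 1 else 0 := by
  split_ifs with hki
  · exact Module.rank_eq_one_iff_finrank_eq_one.2 (h.standard_mult i k hki)
  · have : Subsingleton (smulRange K (e k) (standardModule e i)) := by
      refine ⟨fun x y => Subtype.ext ?_⟩
      obtain ⟨_, x, rfl⟩ := x
      obtain ⟨_, y, rfl⟩ := y
      simp only [Algebra.lsmul_coe, smul_standardModule_eq_zero hki]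
    exact rank_subsingleton' K _

/-- The filtration chosen in `standardMult` itself serves, so independence of the multiplicities
from the filtration is not needed. -/
theorem exists_filtration_proj (h : IsOneQuasiHereditary K e) (j : V) :
    ∃ l : List V, HasStandardFiltration e (projModule e j) l ∧
      ∀ [DecidableEq V] (i : V), (j ≤ i → l.count i = 1) ∧ (¬ j ≤ i → l.count i = 0) := by
  have hg := h.proj_good j
  refine ⟨hg.choose, hg.choose_spec, fun i => ⟨fun hji => ?_, fun hji => ?_⟩⟩
  · have := h.proj_mult i j hji
    rw [standardMult, dif_pos hg] at this
    convert this
  · have := h.proj_mult_eq_zero j i hji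
    rw [standardMult, dif_pos hg] at this
    convert this

theorem rank_smulRange_projModule [Fintype V] (h : IsOneQuasiHereditary K e) {k : V}
    (hk : e k * e k = e k) (j : V) :
    Module.rank K (smulRange K (e k) (projModule e j)) = upperCount k j := by
  classical
  obtain ⟨l, hl, hc⟩ := exists_filtration_proj h j
  rw [rank_smulRange_of_filtration hk hl]
  simp only [rank_smulRange_standardModule h]
  rw [Finset.sum_list_map_count, upperCount, Finset.card_filter, Nat.cast_sum,
    Finset.sum_subset (Finset.subset_univ _)]
  · refine Finset.sum_congr rfl fun i _ => ?_
    by_cases hji : j ≤ i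
    · simp [(hc i).1 hji, hji]
    · simp [(hc i).2 hji, hji]
  · intro i _ hi
    simp [List.count_eq_zero.2 (fun h' => hi (List.mem_toFinset.2 h'))]

theorem rank_peirceSpace [Fintype V] (h : IsOneQuasiHereditary K e)
    (hidem : ∀ i, e i * e i = e i) (k j : V) :
    Module.rank K (peirceSpace K e k j) = upperCount k j := by
  rw [← rank_smulRange_projModule h (hidem k) j]
  have : (smulRange K (e k) (projModule e j)).map
      ((projModule e j).subtype.restrictScalars K) = peirceSpace K e k j := by
    ext x
    constructor
    · rintro ⟨_, ⟨y, rfl⟩, rfl⟩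
      have hy := (mem_projModule hidem).1 y.2
      refine mul_mem_peirce (y := e k) (x := (y : A)) (hidem k) hy
    · intro hx
      exact ⟨⟨x, (mem_projModule hidem).2 hx.2⟩,
        ⟨⟨x, (mem_projModule hidem).2 hx.2⟩, Subtype.ext hx.1⟩, rfl⟩
  rw [← this]
  exact ((smulRange K (e k) (projModule e j)).equivMapOfInjective
    ((projModule e j).subtype.restrictScalars K)
    (Submodule.injective_subtype (projModule e j))).symm.rank_eq

end Filtration

end

/-! ### Simple socles from the socle of `P(i)` and the top of `I(i)` -/

noncomputable section

section Socle

variable {A : Type v} [Ring A]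

/-- If the socle of `M` is a simple module fixed by `a`, then `M` has an element fixed by `a` which
lies in every nonzero submodule. -/
theorem exists_mem_forall_submodule {M T : Type*} [AddCommGroup M] [Module A M] [IsArtinian A M]
    [AddCommGroup T] [Module A T] [IsSimpleModule A T] {a : A} (ha : ∀ y : T, a • y = y)
    (φ : moduleSocle A M ≃ₗ[A] T) :
    ∃ t : M, t ≠ 0 ∧ a • t = t ∧ ∀ x : M, x ≠ 0 → ∃ z : A, z • x = t := by
  have := IsSimpleModule.nontrivial A T
  obtain ⟨u, hu⟩ := exists_ne (0 : T)
  refine ⟨φ.symm u, ?_, ?_, fun x hx => ?_⟩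
  · simpa using hu
  · rw [← Submodule.coe_smul, ← map_smul, ha]
  · obtain ⟨N, hN, hNx⟩ := (IsAtomic.eq_bot_or_exists_atom_le (Submodule.span A {x})).resolve_left
      (by simpa using hx)
    have hNs : N ≤ moduleSocle A M := le_sSup (isSimpleModule_iff_isAtom.2 hN)
    obtain ⟨y, hy, hy0⟩ := N.ne_bot_iff.1 hN.1
    obtain ⟨b, hb⟩ := Submodule.mem_span_singleton.1 (hNx hy)
    obtain ⟨c, hc⟩ := IsSimpleModule.toSpanSingleton_surjective A
      (m := φ ⟨y, hNs hy⟩) (by simpa using hy0) u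
    refine ⟨c * b, ?_⟩
    rw [mul_smul, hb, ← hc, LinearMap.toSpanSingleton_apply, ← map_smul, φ.symm_apply_apply]
    rfl

/-- If the top of `M` is simple, then the radical of `M` is the largest proper submodule. -/
theorem le_jacobson_of_ne_top {M T : Type*} [AddCommGroup M] [Module A M] [IsNoetherian A M]
    [AddCommGroup T] [Module A T] [IsSimpleModule A T] (φ : moduleTop A M ≃ₗ[A] T)
    {W : Submodule A M} (hW : W ≠ ⊤) : W ≤ Module.jacobson A M := by
  obtain ⟨N, hN, hWN⟩ := (IsCoatomic.eq_top_or_exists_le_coatom W).resolve_left hW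
  have hJN : Module.jacobson A M ≤ N := sInf_le hN
  have : IsSimpleModule A (moduleTop A M) := IsSimpleModule.congr φ
  have hJ : IsCoatom (Module.jacobson A M) := isSimpleModule_iff_isCoatom.1 this
  exact hWN.trans (hJ.le_iff_eq hN.1 |>.1 hJN).le

theorem smul_sub_mem_jacobson {M T : Type*} [AddCommGroup M] [Module A M]
    [AddCommGroup T] [Module A T] {a : A} (ha : ∀ y : T, a • y = y)
    (φ : moduleTop A M ≃ₗ[A] T) (f : M) : a • f - f ∈ Module.jacobson A M := by
  rw [← Submodule.Quotient.mk_eq_zero, Submodule.Quotient.mk_sub, Submodule.Quotient.mk_smul,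
    sub_eq_zero]
  apply φ.injective
  rw [map_smul, ha]

variable {K : Type u} [Field K] [Algebra K A] {V : Type w} {e : V → A}

instance : IsScalarTower K A (RegularDual K A) :=
  ⟨fun c a f => RegularDual.ext K fun x => by
    rw [RegularDual.smul_apply, mul_smul_comm, RegularDual.map_smul]
    rfl⟩

instance [Module.Finite K A] : Module.Finite K (RegularDual K A) :=
  inferInstanceAs (Module.Finite K (Module.Dual K A))

/-- The linear form `x ↦ g (e_i x)`, as an element of `I(i)`. -/
def injModule.ofDual (hidem : ∀ i, e i * e i = e i) (i : V) (g : Module.Dual K A) :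
    injModule K e i :=
  ⟨(show Module.Dual K A from g ∘ₗ LinearMap.mulLeft K (e i)), fun x => by
    change g (e i * (e i * x)) = g (e i * x)
    rw [← mul_assoc, hidem]⟩

theorem injModule.ofDual_apply (hidem : ∀ i, e i * e i = e i) (i : V) (g : Module.Dual K A)
    (x : A) : (injModule.ofDual hidem i g).1 x = g (e i * x) := rfl

/-- The submodule of the forms in `I(i)` which vanish on the right ideal `x A`. -/
def injModule.annihilator (K : Type u) [Field K] [Algebra K A] (e : V → A) (i : V) (x : A) :
    Submodule A (injModule K e i) where
  carrier := {f | ∀ y, f.1 (x * y) = 0}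
  add_mem' := fun hf hg y => by
    rw [Submodule.coe_add, RegularDual.add_apply, hf, hg, add_zero]
  zero_mem' := fun y => by simp
  smul_mem' := fun a f hf y => by
    rw [Submodule.coe_smul, RegularDual.smul_apply, mul_assoc]
    exact hf _

/-- Duality turns the simple top of `I(i)` into a simple socle of `e_i A`. For nonzero `y` in `e_i
A`, the forms vanishing on `y A` form a proper submodule of `I(i)`, hence lie in the radical, so
whatever the radical annihilates in `e_i A` belongs to `y A`. -/
theorem exists_right_socle [Module.Finite K A] (hidem : ∀ i, e i * e i = e i) {T : Type*}
    [AddCommGroup T] [Module A T] [IsSimpleModule A T] {o : V} (ho : ∀ y : T, e o • y = y) {i : V}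
    (φ : moduleTop A (injModule K e i) ≃ₗ[A] T) :
    ∃ s ∈ peirceSpace K e i o, s ≠ 0 ∧ ∀ x, e i * x = x → x ≠ 0 → ∃ z, x * z = s := by
  have : IsNoetherian A (RegularDual K A) := isNoetherian_of_tower K inferInstance
  set J := Module.jacobson A (injModule K e i)
  have hJtop : J ≠ ⊤ := by
    intro h
    have h1 : Subsingleton (moduleTop A (injModule K e i)) :=
      Submodule.Quotient.subsingleton_iff.2 h
    have h2 : Subsingleton T := φ.symm.injective.subsingleton
    exact not_subsingleton_iff_nontrivial.2 (IsSimpleModule.nontrivial A T) h2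
  obtain ⟨f₀, -, hf₀⟩ := SetLike.exists_of_lt (lt_top_iff_ne_top.2 hJtop)
  let D : Submodule K (Module.Dual K A) :=
    ((J.map (injModule K e i).subtype).restrictScalars K : Submodule K (RegularDual K A))
  -- In finite dimension `J` is the full annihilator of its common zeros, so `f₀ ∉ J` is detected at
  -- such a zero `x`.
  have hx : ∃ x : A, (∀ f ∈ J, f.1 x = 0) ∧ f₀.1 x ≠ 0 := by
    by_contra! hcon
    let g₀ : Module.Dual K A := f₀.1
    have : g₀ ∈ D.dualCoannihilator.dualAnnihilator := by
      rw [Submodule.mem_dualAnnihilator]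
      intro x hx
      exact hcon x fun f hf => (Submodule.mem_dualCoannihilator x).1 hx f.1 ⟨f, hf, rfl⟩
    rw [Subspace.dualCoannihilator_dualAnnihilator_eq] at this
    obtain ⟨f, hf, hff⟩ := this
    exact hf₀ (Subtype.ext hff ▸ hf)
  obtain ⟨x, hx, hx0⟩ := hx
  have heval : ∀ f : injModule K e i, f.1 (e i * x * e o) = (e o • f).1 x := fun f => by
    rw [mul_assoc, f.2, Submodule.coe_smul, RegularDual.smul_apply]
  -- The idempotent `e_o` acts as the identity on the top, so `e_o f₀ - f₀` lies in `J` and vanishes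
  -- at `x`.
  have hs0 : f₀.1 (e i * x * e o) = f₀.1 x := by
    have := hx _ (smul_sub_mem_jacobson ho φ f₀)
    rw [heval, ← sub_eq_zero]
    exact this
  refine ⟨e i * x * e o, ⟨by rw [← mul_assoc, ← mul_assoc, hidem], by rw [mul_assoc, hidem]⟩,
    fun h => hx0 (by rw [← hs0, h, RegularDual.map_zero]), fun y hy hy0 => ?_⟩
  have hproper : injModule.annihilator K e i y ≠ ⊤ := by
    intro htop
    obtain ⟨g, hg⟩ := Module.Projective.exists_dual_ne_zero K hy0
    have : injModule.ofDual hidem i g ∈ injModule.annihilator K e i y := htop ▸ trivial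
    have := this 1
    rw [injModule.ofDual_apply, mul_one, hy] at this
    exact hg this
  have hle := le_jacobson_of_ne_top φ hproper
  by_contra hcon
  have hnot : e i * x * e o ∉ LinearMap.range (LinearMap.mulLeft K y) := by
    rintro ⟨z, hz⟩
    exact hcon ⟨z, hz⟩
  obtain ⟨g, hg, hgy⟩ := Submodule.exists_le_ker_of_notMem hnot
  have hmem : injModule.ofDual hidem i g ∈ injModule.annihilator K e i y := fun z => by
    rw [injModule.ofDual_apply, ← mul_assoc, hy]
    exact hgy ⟨z, rfl⟩
  -- The form built from `g` vanishes on `y A`, hence lies in `J`. Its `e_o`-multiple then vanishes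
  -- at `x`, which says `g (e_i x e_o) = 0`.
  have h1 := hx _ (J.smul_mem (e o) (hle hmem))
  rw [← heval, injModule.ofDual_apply, ← mul_assoc, ← mul_assoc, hidem] at h1
  exact hg h1

theorem exists_left_socle [IsArtinian A A] (hidem : ∀ i, e i * e i = e i) {T : Type*}
    [AddCommGroup T] [Module A T] [IsSimpleModule A T] {o : V} (ho : ∀ y : T, e o • y = y) {i : V}
    (φ : moduleSocle A (projModule e i) ≃ₗ[A] T) :
    ∃ t ∈ peirceSpace K e o i, t ≠ 0 ∧ ∀ x, x * e i = x → x ≠ 0 → ∃ z, z * x = t := by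
  obtain ⟨t, ht0, ht, H⟩ := exists_mem_forall_submodule ho φ
  refine ⟨t, ⟨congrArg Subtype.val ht, (mem_projModule hidem).1 t.2⟩, by simpa using ht0,
    fun x hx hx0 => ?_⟩
  obtain ⟨z, hz⟩ := H ⟨x, (mem_projModule hidem).2 hx⟩ (by simpa using hx0)
  exact ⟨z, congrArg Subtype.val hz⟩

variable [Fintype V]

theorem finite_of_finite_peirceSpace (hidem : ∀ i, e i * e i = e i) (hsum : ∑ i, e i = 1)
    (h : ∀ k j, Module.Finite K (peirceSpace K e k j)) : Module.Finite K A := by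
  have htop : (⨆ p : V × V, peirceSpace K e p.1 p.2) = ⊤ := by
    rw [eq_top_iff]
    intro x _
    have : x = ∑ k, ∑ j, e k * x * e j := by
      simp only [← Finset.mul_sum, hsum, mul_one, ← Finset.sum_mul, one_mul]
    rw [this]
    refine sum_mem fun k _ => sum_mem fun j _ => Submodule.mem_iSup_of_mem (k, j) ?_
    exact ⟨by rw [← mul_assoc, ← mul_assoc, hidem], by rw [mul_assoc, hidem]⟩
  have : Module.Finite K (⨆ p : V × V, peirceSpace K e p.1 p.2 : Submodule K A) := inferInstance
  rw [htop] at this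
  exact Module.Finite.equiv (Submodule.topEquiv : (⊤ : Submodule K A) ≃ₗ[K] A)

theorem IsOneQuasiHereditary.hasMinimalSocles [PartialOrder V] (h : IsOneQuasiHereditary K e)
    (hidem : ∀ i, e i * e i = e i) (hsum : ∑ i, e i = 1)
    (hsimple : ∀ i, IsSimpleModule A (simpleModule e i) ∧ ∀ y : simpleModule e i, e i • y = y) :
    ∃ o, HasMinimalSocles K e o := by
  obtain ⟨o, m, hle, hsoc, -⟩ := h.exists_min_max
  have hrank := rank_peirceSpace h hidem
  have : Module.Finite K A := finite_of_finite_peirceSpace hidem hsum fun k j =>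
    Module.rank_lt_aleph0_iff.1 (by rw [hrank]; exact Cardinal.natCast_lt_aleph0)
  have : IsArtinian A A := isArtinian_of_tower K inferInstance
  have := (hsimple o).1
  exact ⟨o, hidem, fun i => (hle i).1,
    fun i => exists_left_socle hidem (hsimple o).2 (hsoc i).1.some,
    fun i => exists_right_socle hidem (hsimple o).2 (hsoc i).2.some, hrank⟩

end Socle

end

/-! ### Path length and idempotents in `KQ/I` -/

noncomputable section

section PathAlgebraQuotient

variable {K : Type u} [Field K] {V : Type w} [Quiver.{v} V]

namespace PathAlgebra

theorem concat_apply_eq_zero {i j k : V} (y : Quiver.Path j k →₀ K) (x : Quiver.Path i j →₀ K)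
    (p : Quiver.Path i k) (h : ∀ q r, r.comp q = p → y q = 0 ∨ x r = 0) : concat y x p = 0 := by
  classical
  rw [concat, Finsupp.sum_apply]
  refine Finset.sum_eq_zero fun q _ => ?_
  beta_reduce
  rw [Finsupp.sum_apply]
  refine Finset.sum_eq_zero fun r _ => ?_
  beta_reduce
  by_cases hp : r.comp q = p
  · rcases h q r hp with h | h <;> simp [h]
  · rw [Finsupp.single_eq_of_ne (Ne.symm hp)]

theorem ofPath_apply_self {i j : V} (p : Quiver.Path i j) :
    (ofPath p : PathAlgebra K V) i j = Finsupp.single p 1 := by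
  classical
  simp [ofPath]

theorem ofPath_apply_of_ne_right {i j k : V} (p : Quiver.Path i j) (h : k ≠ j) :
    (ofPath p : PathAlgebra K V) i k = 0 := by
  classical
  simp [ofPath, Pi.single_eq_of_ne h]

theorem ofPath_apply_of_ne_left {i j l k : V} (p : Quiver.Path i j) (h : l ≠ i) :
    (ofPath p : PathAlgebra K V) l k = 0 := by
  classical
  simp [ofPath, Pi.single_eq_of_ne h]

theorem finset_sum_apply {ι : Type*} (s : Finset ι) (f : ι → PathAlgebra K V) (i j : V) :
    (∑ a ∈ s, f a) i j = ∑ a ∈ s, f a i j := by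
  classical
  induction s using Finset.induction_on with
  | empty => simp
  | insert a s ha ih => rw [Finset.sum_insert ha, Finset.sum_insert ha, add_apply, ih]

variable [Fintype V]

theorem eq_sum_ofPath (x : PathAlgebra K V) :
    x = ∑ i, ∑ j, (x i j).sum fun p c => c • (ofPath p : PathAlgebra K V) := by
  classical
  ext1 a b
  simp only [Finsupp.sum, finset_sum_apply, smul_apply]
  rw [Finset.sum_eq_single a, Finset.sum_eq_single b]
  · simp only [ofPath_apply_self, Finsupp.smul_single, smul_eq_mul, mul_one]
    exact (Finsupp.sum_single (x a b)).symm
  · intro j _ hj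
    exact Finset.sum_eq_zero fun p _ => by rw [ofPath_apply_of_ne_right p hj.symm, smul_zero]
  · simp
  · intro i _ hi
    exact Finset.sum_eq_zero fun j _ => Finset.sum_eq_zero fun p _ => by
      rw [ofPath_apply_of_ne_left p hi.symm, smul_zero]
  · simp

/-- `x` is a linear combination of paths of length at least `n`. -/
def LengthGE (n : ℕ) (x : PathAlgebra K V) : Prop :=
  ∀ (i j : V) (p : Quiver.Path i j), p.length < n → x i j p = 0

theorem LengthGE.mul {m n : ℕ} {y x : PathAlgebra K V} (hy : LengthGE m y) (hx : LengthGE n x) :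
    LengthGE (m + n) (y * x) := by
  intro i k p hp
  rw [mul_apply, Finsupp.finsetSum_apply]
  refine Finset.sum_eq_zero fun j _ => concat_apply_eq_zero _ _ _ fun q r hqr => ?_
  by_contra! hcon
  have h1 := mt (hy j k q) hcon.1
  have h2 := mt (hx i j r) hcon.2
  rw [← hqr, Quiver.Path.length_comp] at hp
  omega

theorem LengthGE.pow {x : PathAlgebra K V} (hx : LengthGE 1 x) (n : ℕ) : LengthGE n (x ^ n) := by
  induction n with
  | zero => exact fun _ _ _ hp => absurd hp (Nat.not_lt_zero _)
  | succ n ih => rw [pow_succ]; exact ih.mul hx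

variable {I : Ideal (PathAlgebra K V)}

theorem IsAdmissible.isNilpotent_mk [I.IsTwoSided] (hI : IsAdmissible I) {x : PathAlgebra K V}
    (hx : LengthGE 1 x) : IsNilpotent (Ideal.Quotient.mk I x) := by
  obtain ⟨N, hN⟩ := hI.exists_pow_le
  refine ⟨N, ?_⟩
  rw [← map_pow, Ideal.Quotient.eq_zero_iff_mem, eq_sum_ofPath (x ^ N)]
  refine sum_mem fun i _ => sum_mem fun j _ => sum_mem fun p hp => ?_
  refine Submodule.smul_of_tower_mem I _ (hN i j p ?_)
  by_contra hlt
  exact Finsupp.mem_support_iff.1 hp (hx.pow N i j p (not_le.1 hlt))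

theorem IsAdmissible.apply_eq_of_mk_eq [I.IsTwoSided] (hI : IsAdmissible I)
    {x y : PathAlgebra K V} (h : Ideal.Quotient.mk I x = Ideal.Quotient.mk I y) {i j : V}
    {p : Quiver.Path i j} (hp : p.length < 2) : x i j p = y i j p := by
  have := hI.two_le_length _ (Ideal.Quotient.eq.1 h) i j p hp
  rw [sub_eq_add_neg, add_apply, Finsupp.add_apply] at this
  have hneg : (-y) i j p = - (y i j p) := rfl
  rwa [hneg, ← sub_eq_add_neg, sub_eq_zero] at this

variable [I.IsTwoSided]

theorem pathClass_comp {i j k : V} (p : Quiver.Path i j) (q : Quiver.Path j k) :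
    pathClass I (p.comp q) = pathClass I q * pathClass I p := by
  rw [pathClass, pathClass, pathClass, ← map_mul, ofPath_mul_ofPath]

theorem pathClass_cons {i j k : V} (p : Quiver.Path i j) (α : j ⟶ k) :
    pathClass I (p.cons α) = pathClass I α.toPath * pathClass I p := by
  rw [← pathClass_comp, Quiver.Path.comp_toPath_eq_cons]

theorem pathClass_mem_peirceSpace {i j : V} (p : Quiver.Path i j) :
    pathClass I p ∈ peirceSpace K (vertexIdem I) j i :=
  ⟨by rw [vertexIdem, ← pathClass_comp, Quiver.Path.comp_nil],
    by rw [vertexIdem, ← pathClass_comp, Quiver.Path.nil_comp]⟩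

theorem vertexIdem_mul_self (i : V) : vertexIdem I i * vertexIdem I i = vertexIdem I i :=
  (pathClass_mem_peirceSpace Quiver.Path.nil).1

theorem sum_vertexIdem : ∑ i, vertexIdem I i = 1 := by
  simp only [vertexIdem, pathClass]
  rw [← map_sum, ← map_one (Ideal.Quotient.mk I)]
  congr 1
  ext1 i j
  rw [finset_sum_apply, Finset.sum_eq_single i (fun k _ hk => ofPath_apply_of_ne_left _ hk.symm)
    (by simp)]
  by_cases hij : j = i
  · subst hij
    rw [ofPath_apply_self, one_apply_self]
  · rw [ofPath_apply_of_ne_right _ hij, one_apply_of_ne hij]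

theorem vertexIdem_mul_pathClass_of_ne {i j k : V} (h : k ≠ j) (p : Quiver.Path i j) :
    vertexIdem I k * pathClass I p = 0 := by
  rw [vertexIdem, pathClass, pathClass, ← map_mul]
  convert map_zero (Ideal.Quotient.mk I)
  ext1 a b
  rw [mul_apply]
  refine Finset.sum_eq_zero fun l _ => ?_
  by_cases hl : l = k
  · subst hl
    by_cases ha : a = i
    · subst ha
      rw [ofPath_apply_of_ne_right p h, concat_zero]
    · rw [ofPath_apply_of_ne_left p ha, concat_zero]
  · rw [ofPath_apply_of_ne_left _ hl, zero_concat]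

theorem pathClass_mul_vertexIdem_of_ne {i j k : V} (h : k ≠ i) (p : Quiver.Path i j) :
    pathClass I p * vertexIdem I k = 0 := by
  rw [← (pathClass_mem_peirceSpace (I := I) p).2, mul_assoc, vertexIdem, vertexIdem, ← vertexIdem,
    vertexIdem_mul_pathClass_of_ne h.symm, mul_zero]

theorem peirceSpace_le_span (k j : V) : peirceSpace K (vertexIdem I) k j ≤
    Submodule.span K (Set.range fun p : Quiver.Path j k => pathClass I p) := by
  intro a ha
  obtain ⟨x, rfl⟩ := Ideal.Quotient.mk_surjective a
  rw [← ha.2, ← ha.1, eq_sum_ofPath x]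
  have hsmul : ∀ (c : K) {i l : V} (p : Quiver.Path i l),
      Ideal.Quotient.mk I (c • ofPath p) = c • pathClass I p := fun _ _ _ _ => rfl
  simp only [map_sum, Finsupp.sum, Finset.mul_sum, Finset.sum_mul, hsmul, mul_smul_comm,
    smul_mul_assoc]
  refine sum_mem fun i _ => sum_mem fun l _ => sum_mem fun p _ => Submodule.smul_mem _ _ ?_
  by_cases hl : k = l
  · subst hl
    by_cases hi : j = i
    · subst hi
      rw [(pathClass_mem_peirceSpace p).1, (pathClass_mem_peirceSpace p).2]
      exact Submodule.subset_span ⟨p, rfl⟩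
    · rw [mul_assoc, pathClass_mul_vertexIdem_of_ne hi, mul_zero]
      exact zero_mem _
  · rw [vertexIdem_mul_pathClass_of_ne hl, zero_mul]
    exact zero_mem _

theorem sub_apply (x y : PathAlgebra K V) (i j : V) : (x - y) i j = x i j - y i j := rfl

theorem mul_ofPath_apply_self {i j : V} (y : PathAlgebra K V) (p : Quiver.Path i j) (k : V) :
    (y * ofPath p : PathAlgebra K V) i k = concat (y j k) (Finsupp.single p 1) := by
  rw [mul_apply, Finset.sum_eq_single j, ofPath_apply_self]
  · intro l _ hl
    rw [ofPath_apply_of_ne_right p hl, concat_zero]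
  · simp

theorem mul_ofPath_apply_of_ne {i j l : V} (y : PathAlgebra K V) (p : Quiver.Path i j)
    (h : l ≠ i) (k : V) : (y * ofPath p : PathAlgebra K V) l k = 0 := by
  rw [mul_apply]
  exact Finset.sum_eq_zero fun m _ => by rw [ofPath_apply_of_ne_left p h, concat_zero]

theorem ofPath_mul_apply_self {i j : V} (y : PathAlgebra K V) (p : Quiver.Path i j) (k : V) :
    (ofPath p * y : PathAlgebra K V) k j = concat (Finsupp.single p 1) (y k i) := by
  rw [mul_apply, Finset.sum_eq_single i, ofPath_apply_self]
  · intro l _ hl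
    rw [ofPath_apply_of_ne_left p hl, zero_concat]
  · simp

theorem ofPath_mul_apply_of_ne {i j l : V} (y : PathAlgebra K V) (p : Quiver.Path i j)
    (h : l ≠ j) (k : V) : (ofPath p * y : PathAlgebra K V) k l = 0 := by
  rw [mul_apply]
  refine Finset.sum_eq_zero fun m _ => ?_
  by_cases hm : m = i
  · subst hm
    rw [ofPath_apply_of_ne_right p h, zero_concat]
  · rw [ofPath_apply_of_ne_left p hm, zero_concat]

/-! ### The radical of `P(i)` and its simple top -/

variable (I) in
/-- The generator `e_i` of `P(i)`. -/
def projGen (i : V) : projModule (vertexIdem I) i :=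
  ⟨vertexIdem I i, Submodule.mem_span_singleton_self _⟩

theorem coe_smul_projGen {i : V} (x : projModule (vertexIdem I) i) : x.1 • projGen I i = x :=
  Subtype.ext ((mem_projModule vertexIdem_mul_self).1 x.2)

/-- The radical of `P(i)` contains the classes of combinations of paths of positive length. -/
theorem mem_jacobson_of_lengthGE (hI : IsAdmissible I) {i : V} {x : PathAlgebra K V}
    (hx : LengthGE 1 x) (ν : projModule (vertexIdem I) i) (hν : Ideal.Quotient.mk I x = ν) :
    ν ∈ Module.jacobson (PathAlgebra K V ⧸ I) (projModule (vertexIdem I) i) := by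
  refine Submodule.mem_sInf.2 fun M hM => ?_
  by_contra hνM
  have htop : M ⊔ Submodule.span _ {ν} = ⊤ :=
    hM.2 _ (left_lt_sup.2 fun h => hνM (h (Submodule.mem_span_singleton_self ν)))
  obtain ⟨m, hm, n, hn, hmn⟩ := Submodule.mem_sup.1 (htop ▸ Submodule.mem_top : projGen I i ∈ _)
  obtain ⟨a, rfl⟩ := Submodule.mem_span_singleton.1 hn
  obtain ⟨y, rfl⟩ := Ideal.Quotient.mk_surjective a
  -- With `e_i = m + y ν` and `y ν` nilpotent, `m = (1 - y ν) e_i` for a unit `1 - y ν`. Then `e_i`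
  -- lies in `M`, contradicting maximality.
  have hnil : IsNilpotent (Ideal.Quotient.mk I y * ν.1) := by
    rw [← hν, ← map_mul]
    refine hI.isNilpotent_mk ?_
    have := LengthGE.mul (m := 0) (y := y) (fun _ _ _ h => absurd h (Nat.not_lt_zero _)) hx
    rwa [zero_add] at this
  obtain ⟨b, hb⟩ := hnil.isUnit_one_sub.exists_left_inv
  have hm' : m = (1 - Ideal.Quotient.mk I y * ν.1) • projGen I i := by
    rw [sub_smul, one_smul, mul_smul, coe_smul_projGen, ← hmn, add_sub_cancel_right]
  have hε : projGen I i ∈ M := by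
    have := M.smul_mem b hm
    rwa [hm', smul_smul, hb, one_smul] at this
  refine hM.1 (eq_top_iff.2 fun z _ => ?_)
  rw [← coe_smul_projGen z]
  exact M.smul_mem _ hε

theorem exists_sub_smul_mem_jacobson (hI : IsAdmissible I) {i : V}
    (x : projModule (vertexIdem I) i) : ∃ c : K, x - c • projGen I i ∈
      Module.jacobson (PathAlgebra K V ⧸ I) (projModule (vertexIdem I) i) := by
  obtain ⟨y, hy⟩ := Ideal.Quotient.mk_surjective x.1
  -- The scalar is the coefficient of the trivial path at `i`. What remains of `y e_i` involves only
  -- paths of positive length.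
  refine ⟨y i i Quiver.Path.nil, mem_jacobson_of_lengthGE hI
    (x := y * ofPath (Quiver.Path.nil : Quiver.Path i i) -
      y i i Quiver.Path.nil • ofPath (Quiver.Path.nil : Quiver.Path i i)) ?_
    (x - y i i Quiver.Path.nil • projGen I i) ?_⟩
  · intro a b p hp
    cases p with
    | cons p α => simp at hp
    | nil =>
      rw [sub_apply, smul_apply]
      by_cases ha : a = i
      · subst ha
        rw [mul_ofPath_apply_self, ofPath_apply_self, concat_nil]
        simp
      · rw [mul_ofPath_apply_of_ne _ _ ha, ofPath_apply_of_ne_left _ ha]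
        simp
  · rw [map_sub, map_mul, hy]
    exact congrArg (· - y i i Quiver.Path.nil • vertexIdem I i)
      ((mem_projModule vertexIdem_mul_self).1 x.2)

theorem vertexIdem_ne_zero (hI : IsAdmissible I) (i : V) : vertexIdem I i ≠ 0 := by
  intro h
  rw [vertexIdem, pathClass, ← map_zero (Ideal.Quotient.mk I)] at h
  have := hI.apply_eq_of_mk_eq h (i := i) (j := i) (p := Quiver.Path.nil) (by simp)
  rw [ofPath_apply_self] at this
  simp at this

theorem exists_eq_smul_mk_projGen (hI : IsAdmissible I) {i : V}
    (x : simpleModule (vertexIdem I) i) :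
    ∃ c : K, x = algebraMap K (PathAlgebra K V ⧸ I) c • Submodule.Quotient.mk (projGen I i) := by
  obtain ⟨x, rfl⟩ := Submodule.Quotient.mk_surjective _ x
  obtain ⟨c, hc⟩ := exists_sub_smul_mem_jacobson hI x
  refine ⟨c, ?_⟩
  rw [← Submodule.Quotient.mk_smul, algebraMap_smul]
  exact (Submodule.Quotient.eq _).2 hc

/-- Since `P(i) = K e_i + rad P(i)`, the top is spanned over `K` by the class of `e_i`. -/
theorem isSimpleModule_simpleModule (hI : IsAdmissible I) (i : V) :
    IsSimpleModule (PathAlgebra K V ⧸ I) (simpleModule (vertexIdem I) i) := by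
  rw [isSimpleModule_iff_toSpanSingleton_surjective]
  refine ⟨?_, fun x hx y => ?_⟩
  · have : Nontrivial (projModule (vertexIdem I) i) :=
      ⟨projGen I i, 0, fun h => vertexIdem_ne_zero hI i (congrArg Subtype.val h)⟩
    exact Submodule.Quotient.nontrivial_iff.2 (Module.jacobson_lt_top _ _).ne
  · obtain ⟨c, rfl⟩ := exists_eq_smul_mk_projGen hI x
    obtain ⟨d, rfl⟩ := exists_eq_smul_mk_projGen hI y
    have hc : c ≠ 0 := fun hc => hx (by rw [hc, map_zero, zero_smul])
    refine ⟨algebraMap K _ (d / c), ?_⟩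
    rw [LinearMap.toSpanSingleton_apply, smul_smul, ← map_mul, div_mul_cancel₀ d hc]

theorem vertexIdem_smul_simpleModule (hI : IsAdmissible I) (i : V)
    (x : simpleModule (vertexIdem I) i) : vertexIdem I i • x = x := by
  obtain ⟨c, rfl⟩ := exists_eq_smul_mk_projGen hI x
  rw [smul_smul, ← Algebra.commutes, mul_smul, ← Submodule.Quotient.mk_smul]
  congr 2
  exact coe_smul_projGen (projGen I i)

/-! ### Arrows modulo an admissible ideal, and absence of loops -/

/-- If an arrow `α : b → c` with `b ≠ c` lies in `A w` for a path `w : b → c`, then `w = α`. -/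
theorem eq_toPath_of_mul_eq (hI : IsAdmissible I) {b c : V} (hbc : b ≠ c) (α : b ⟶ c)
    (w : Quiver.Path b c) {y : PathAlgebra K V ⧸ I}
    (h : y * pathClass I w = pathClass I α.toPath) : w = α.toPath := by
  obtain ⟨y, rfl⟩ := Ideal.Quotient.mk_surjective y
  rw [pathClass, pathClass, ← map_mul] at h
  have := hI.apply_eq_of_mk_eq h (i := b) (j := c) (p := α.toPath) (by simp)
  rw [mul_ofPath_apply_self, ofPath_apply_self, Finsupp.single_eq_same] at this
  by_contra hw
  -- The coefficient of `α` is well defined modulo `I`. In `y w` it vanishes unless `w = α`, because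
  -- `w` already has positive length.
  refine zero_ne_one (this ▸ (concat_apply_eq_zero _ _ _ fun q r hqr => ?_).symm)
  by_cases hr : r = w
  · subst hr
    have hlen := congrArg Quiver.Path.length hqr
    rw [Quiver.Path.length_comp, Quiver.Path.length_toPath] at hlen
    have hr0 : r.length ≠ 0 := fun h0 => hbc (Quiver.Path.eq_of_length_zero r h0)
    have hq := Quiver.Path.eq_nil_of_length_zero q (by omega)
    rw [hq, Quiver.Path.comp_nil] at hqr
    exact absurd hqr hw
  · exact Or.inr (Finsupp.single_eq_of_ne hr)

theorem eq_toPath_of_mul_eq' (hI : IsAdmissible I) {b c : V} (hbc : b ≠ c) (α : b ⟶ c)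
    (w : Quiver.Path b c) {y : PathAlgebra K V ⧸ I}
    (h : pathClass I w * y = pathClass I α.toPath) : w = α.toPath := by
  obtain ⟨y, rfl⟩ := Ideal.Quotient.mk_surjective y
  rw [pathClass, pathClass, ← map_mul] at h
  have := hI.apply_eq_of_mk_eq h (i := b) (j := c) (p := α.toPath) (by simp)
  rw [ofPath_mul_apply_self, ofPath_apply_self, Finsupp.single_eq_same] at this
  by_contra hw
  refine zero_ne_one (this ▸ (concat_apply_eq_zero _ _ _ fun q r hqr => ?_).symm)
  by_cases hq : q = w
  · subst hq
    have hlen := congrArg Quiver.Path.length hqr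
    rw [Quiver.Path.length_comp, Quiver.Path.length_toPath] at hlen
    have hq0 : q.length ≠ 0 := fun h0 => hbc (Quiver.Path.eq_of_length_zero q h0)
    have hr := Quiver.Path.eq_nil_of_length_zero r (by omega)
    rw [hr, Quiver.Path.nil_comp] at hqr
    exact absurd hqr hw
  · exact Or.inl (Finsupp.single_eq_of_ne hq)

variable (I) in
/-- The elements of `P(i)` represented by combinations of paths without trivial paths and loops
at `i`. -/
def loopFree (i : V) : Submodule (PathAlgebra K V ⧸ I) (projModule (vertexIdem I) i) where
  carrier := {x | ∃ y, Ideal.Quotient.mk I y = x.1 ∧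
    ∀ p : Quiver.Path i i, p.length < 2 → y i i p = 0}
  add_mem' := by
    rintro _ _ ⟨y, hy, hy'⟩ ⟨z, hz, hz'⟩
    refine ⟨y + z, by rw [map_add, hy, hz]; rfl, fun p hp => ?_⟩
    rw [add_apply, Finsupp.add_apply, hy' p hp, hz' p hp, add_zero]
  zero_mem' := ⟨0, map_zero _, fun _ _ => rfl⟩
  smul_mem' := by
    rintro a _ ⟨y, hy, hy'⟩
    obtain ⟨z, rfl⟩ := Ideal.Quotient.mk_surjective a
    refine ⟨z * y, by rw [map_mul, hy]; rfl, fun p hp => ?_⟩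
    rw [mul_apply, Finsupp.finsetSum_apply]
    refine Finset.sum_eq_zero fun j _ => concat_apply_eq_zero _ _ _ fun q r hqr => ?_
    have hlen := congrArg Quiver.Path.length hqr
    rw [Quiver.Path.length_comp] at hlen
    -- A path from `i` to `i` of length below 2 cannot pass through another vertex, so
    -- multiplication creates no trivial path or loop at `i`.
    by_cases hj : j = i
    · subst hj
      exact Or.inr (hy' r (by omega))
    · have hq : q.length ≠ 0 := fun h0 => hj (Quiver.Path.eq_of_length_zero q h0)
      have hr : r.length ≠ 0 := fun h0 => hj (Quiver.Path.eq_of_length_zero r h0).symm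
      omega

theorem standardKer_le_loopFree [PartialOrder V] (i : V) :
    standardKer (vertexIdem I) i ≤ loopFree I i := by
  refine sInf_le fun k hk x => ?_
  obtain ⟨y, hy⟩ := Ideal.Quotient.mk_surjective x.1
  refine ⟨ofPath (Quiver.Path.nil : Quiver.Path k k) * y, by rw [map_mul, hy]; rfl, fun p _ => ?_⟩
  rw [ofPath_mul_apply_of_ne _ _ (by rintro rfl; exact hk le_rfl)]
  rfl

/-- The kernel of `P(i) → Δ(i)` is generated by elements ending at vertices `k ≰ i`, so it contains
no nontrivial combination of `e_i` and a loop. A loop would thus make `e_i Δ(i)` at least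
two-dimensional, against `[Δ(i) : S(i)] = 1`. -/
theorem isEmpty_loop [PartialOrder V] (hI : IsAdmissible I)
    (hA : IsOneQuasiHereditary K (vertexIdem I)) (i : V) : IsEmpty (i ⟶ i) := by
  refine ⟨fun α => ?_⟩
  let a : projModule (vertexIdem I) i := ⟨pathClass I α.toPath, pathClass_mem_projModule I _⟩
  have hmem : ∀ c d : K, c • a + d • projGen I i ∈ standardKer (vertexIdem I) i →
      c = 0 ∧ d = 0 := by
    intro c d h
    obtain ⟨y, hy, hy'⟩ := standardKer_le_loopFree i h
    have hy'' : Ideal.Quotient.mk I y = Ideal.Quotient.mk I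
        (c • ofPath α.toPath + d • ofPath (Quiver.Path.nil : Quiver.Path i i)) := hy
    have h1 := hI.apply_eq_of_mk_eq hy'' (i := i) (j := i) (p := α.toPath) (by simp)
    have h2 := hI.apply_eq_of_mk_eq hy'' (i := i) (j := i) (p := Quiver.Path.nil) (by simp)
    have hne : α.toPath ≠ Quiver.Path.nil := fun h => by
      simpa using congrArg Quiver.Path.length h
    rw [hy' _ (by simp), add_apply, smul_apply, smul_apply, ofPath_apply_self,
      ofPath_apply_self] at h1 h2
    simp only [Finsupp.add_apply, Finsupp.smul_apply, Finsupp.single_eq_same,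
      Finsupp.single_eq_of_ne hne, Finsupp.single_eq_of_ne hne.symm] at h1 h2
    simp only [smul_eq_mul, mul_one, mul_zero, add_zero, zero_add] at h1 h2
    exact ⟨h1.symm, h2.symm⟩
  let R := smulRange K (vertexIdem I i) (standardModule (vertexIdem I) i)
  have hfix : ∀ x : projModule (vertexIdem I) i, vertexIdem I i * x.1 = x.1 →
      Submodule.Quotient.mk x ∈ R := fun x hx =>
    ⟨Submodule.Quotient.mk x, congrArg Submodule.Quotient.mk (Subtype.ext hx)⟩
  let u : R := ⟨_, hfix (projGen I i) (vertexIdem_mul_self i)⟩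
  let v : R := ⟨_, hfix a (pathClass_mem_peirceSpace _).1⟩
  have hu : u ≠ 0 := fun h => by
    have h0 : (Submodule.Quotient.mk (projGen I i) : standardModule (vertexIdem I) i) = 0 :=
      congrArg Subtype.val h
    rw [Submodule.Quotient.mk_eq_zero] at h0
    exact one_ne_zero (hmem 0 1 (by simpa using h0)).2
  obtain ⟨d, hd⟩ := exists_smul_eq_of_finrank_eq_one (hA.standard_self i) hu v
  have h0 : d • (Submodule.Quotient.mk (projGen I i) : standardModule (vertexIdem I) i) =
      Submodule.Quotient.mk a := congrArg Subtype.val hd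
  rw [← Submodule.Quotient.mk_smul, eq_comm, Submodule.Quotient.eq] at h0
  exact one_ne_zero (hmem 1 (-d) (by simpa [sub_eq_add_neg] using h0)).1

end PathAlgebra

end PathAlgebraQuotient

end

/-! ### Monotone paths as injective elements, and stability -/

noncomputable section

section Paths

variable {K : Type u} [Field K] {V : Type w} [Fintype V] [Quiver.{v} V]
  {I : Ideal (PathAlgebra K V)} [I.IsTwoSided]

open PathAlgebra

theorem exists_path_mul_ne_zero {k j : V} {t a : PathAlgebra K V ⧸ I}
    (ha : a ∈ peirceSpace K (vertexIdem I) k j) (hta : t * a ≠ 0) :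
    ∃ p : Quiver.Path j k, t * pathClass I p ≠ 0 := by
  by_contra! hcon
  have hle : Submodule.span K (Set.range fun p : Quiver.Path j k => pathClass I p) ≤
      LinearMap.ker (LinearMap.mulLeft K t) :=
    Submodule.span_le.2 (by rintro _ ⟨p, rfl⟩; exact hcon p)
  exact hta (hle (peirceSpace_le_span k j ha))

theorem exists_path_mul_ne_zero' {k j : V} {b s : PathAlgebra K V ⧸ I}
    (hb : b ∈ peirceSpace K (vertexIdem I) k j) (hbs : b * s ≠ 0) :
    ∃ p : Quiver.Path j k, pathClass I p * s ≠ 0 := by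
  by_contra! hcon
  have hle : Submodule.span K (Set.range fun p : Quiver.Path j k => pathClass I p) ≤
      LinearMap.ker (LinearMap.mulRight K s) :=
    Submodule.span_le.2 (by rintro _ ⟨p, rfl⟩; exact hcon p)
  exact hbs (hle (peirceSpace_le_span k j hb))

variable [PartialOrder V] {o : V}

theorem exists_rightInj_path (h : HasMinimalSocles K (vertexIdem I) o)
    {i j : V} (hji : j ≤ i) :
    ∃ p : Quiver.Path j i, RightInj (vertexIdem I) i (pathClass I p) := by
  obtain ⟨a, ha, t, ht, hta, H⟩ := h.exists_rightInj hji
  obtain ⟨p, hp⟩ := exists_path_mul_ne_zero ha hta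
  exact ⟨p, H _ hp⟩

theorem exists_leftInj_path (h : HasMinimalSocles K (vertexIdem I) o)
    {i k : V} (hki : k ≤ i) :
    ∃ p : Quiver.Path i k, LeftInj (vertexIdem I) i (pathClass I p) := by
  obtain ⟨b, hb, s, hs, hbs, H⟩ := h.exists_leftInj hki
  obtain ⟨p, hp⟩ := exists_path_mul_ne_zero' hb hbs
  exact ⟨p, H _ hp⟩

/-- Any right injective path `w : b → c` satisfies `e_c A e_c w = e_c A e_b`, which contains the
arrow. Hence `w` is the arrow. -/
theorem rightInj_arrow (h : HasMinimalSocles K (vertexIdem I) o)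
    (hI : IsAdmissible I) {b c : V} (hbc : b < c) (α : b ⟶ c) :
    RightInj (vertexIdem I) c (pathClass I α.toPath) := by
  obtain ⟨w, hw⟩ := exists_rightInj_path h hbc.le
  obtain ⟨y, -, hy⟩ := h.exists_mul_eq (pathClass_mem_peirceSpace w) hw
    (upperCount_of_le hbc.le).symm (pathClass_mem_peirceSpace α.toPath)
  rwa [← eq_toPath_of_mul_eq hI hbc.ne α w hy]

theorem leftInj_arrow (h : HasMinimalSocles K (vertexIdem I) o)
    (hI : IsAdmissible I) {b c : V} (hcb : c < b) (α : b ⟶ c) :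
    LeftInj (vertexIdem I) b (pathClass I α.toPath) := by
  obtain ⟨w, hw⟩ := exists_leftInj_path h hcb.le
  obtain ⟨y, -, hy⟩ := h.exists_mul_eq_left (pathClass_mem_peirceSpace w) hw
    (upperCount_of_le hcb.le).symm (pathClass_mem_peirceSpace α.toPath)
  rwa [← eq_toPath_of_mul_eq' hI hcb.ne' α w hy]

/-- Injectivity passes to every arrow of the path, and an injective arrow ascends by
`le_of_rightInj`. -/
theorem isIncreasingPath_of_rightInj (h : HasMinimalSocles K (vertexIdem I) o)
    {a b : V} (p : Quiver.Path a b)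
    (hp : RightInj (vertexIdem I) b (pathClass I p)) : IsIncreasingPath p := by
  induction p with
  | nil => trivial
  | cons p α ih =>
    rw [pathClass_cons, h.rightInj_mul_iff (pathClass_mem_peirceSpace α.toPath)] at hp
    exact ⟨ih hp.1, h.le_of_rightInj (pathClass_mem_peirceSpace α.toPath) hp.2⟩

theorem isDecliningPath_of_leftInj (h : HasMinimalSocles K (vertexIdem I) o)
    {a b : V} (p : Quiver.Path a b)
    (hp : LeftInj (vertexIdem I) a (pathClass I p)) : IsDecliningPath p := by
  induction p with
  | nil => trivial
  | cons p α ih =>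
    rw [pathClass_cons, h.leftInj_mul_iff (pathClass_mem_peirceSpace p)] at hp
    exact ⟨ih hp.2, h.le_of_leftInj (pathClass_mem_peirceSpace α.toPath) hp.1⟩

theorem rightInj_of_isIncreasingPath (h : HasMinimalSocles K (vertexIdem I) o)
    (hI : IsAdmissible I) (hloop : ∀ i : V, IsEmpty (i ⟶ i))
    {a b : V} (p : Quiver.Path a b) (hp : IsIncreasingPath p) :
    RightInj (vertexIdem I) b (pathClass I p) := by
  induction p with
  | nil => exact fun y hy hy0 => hy.symm.trans hy0
  | cons p α ih =>
    rw [pathClass_cons, h.rightInj_mul_iff (pathClass_mem_peirceSpace α.toPath)]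
    -- Increasing paths are defined with `≤`; the absence of loops makes each step strict.
    refine ⟨ih hp.1, rightInj_arrow h hI (lt_of_le_of_ne hp.2 ?_) α⟩
    rintro rfl
    exact (hloop _).elim α

theorem leftInj_of_isDecliningPath (h : HasMinimalSocles K (vertexIdem I) o)
    (hI : IsAdmissible I) (hloop : ∀ i : V, IsEmpty (i ⟶ i))
    {a b : V} (p : Quiver.Path a b) (hp : IsDecliningPath p) :
    LeftInj (vertexIdem I) a (pathClass I p) := by
  induction p with
  | nil => exact fun y hy hy0 => hy.symm.trans hy0
  | cons p α ih =>
    rw [pathClass_cons, h.leftInj_mul_iff (pathClass_mem_peirceSpace p)]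
    refine ⟨leftInj_arrow h hI (lt_of_le_of_ne hp.2 ?_) α, ih hp.1⟩
    rintro rfl
    exact (hloop _).elim α

theorem map_pathModule_le (h : HasMinimalSocles K (vertexIdem I) o)
    (hI : IsAdmissible I) (hloop : ∀ i : V, IsEmpty (i ⟶ i))
    {j i k : V} (hji : j ≤ i) (p : Quiver.Path j i) (q : Quiver.Path i k)
    (hp : IsIncreasingPath p) (hq : IsDecliningPath q)
    (F : Module.End (PathAlgebra K V ⧸ I) (projModule (vertexIdem I) j)) :
    Submodule.map F (pathModule I (p.comp q)) ≤ pathModule I (p.comp q) := by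
  rw [pathModule, Submodule.map_span, Set.image_singleton, Submodule.span_singleton_le_iff_mem]
  obtain ⟨z, hz⟩ := h.exists_mul_eq_mul hji (pathClass_mem_peirceSpace p)
    (rightInj_of_isIncreasingPath h hI hloop p hp) (pathClass_mem_peirceSpace q)
    (leftInj_of_isDecliningPath h hI hloop q hq)
    ((mem_projModule vertexIdem_mul_self).1 (F (projGen I j)).2)
  refine Submodule.mem_span_singleton.2 ⟨z, Subtype.ext ?_⟩
  rw [← pathClass_comp] at hz
  -- Writing the generator as a multiple of `e_j` exhibits `F` as right multiplication by `F (e_j)`,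
  -- the element `x` supplied to `exists_mul_eq_mul`.
  rw [← coe_smul_projGen ⟨pathClass I (p.comp q), pathClass_mem_projModule I _⟩, map_smul]
  refine Eq.trans ?_ hz
  exact congrArg Subtype.val (congrArg (z • ·) (coe_smul_projGen
    (⟨pathClass I (p.comp q), pathClass_mem_projModule I _⟩ : projModule (vertexIdem I) j)))

end Paths

end

theorem theorem2p1 {K : Type u} [Field K] [IsAlgClosed K] {V : Type w} [Fintype V]
    [PartialOrder V] [Quiver.{v} V] [∀ a b : V, Finite (a ⟶ b)]
    (I : Ideal (PathAlgebra K V)) [I.IsTwoSided] (hI : PathAlgebra.IsAdmissible I)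
    (hA : IsOneQuasiHereditary K (PathAlgebra.vertexIdem I))
    (j k i : V) (hji : j ≤ i) (hki : k ≤ i) :
    (∃ p : Quiver.Path j i, IsIncreasingPath p) ∧
    (∃ q : Quiver.Path i k, IsDecliningPath q) ∧
    ∀ (p : Quiver.Path j i) (q : Quiver.Path i k), IsIncreasingPath p → IsDecliningPath q →
      (∀ F : Module.End (PathAlgebra K V ⧸ I) (projModule (PathAlgebra.vertexIdem I) j),
        Submodule.map F (pathModule I (p.comp q)) ≤ pathModule I (p.comp q)) ∧
      ∃ N : Submodule
          (Module.End (PathAlgebra K V ⧸ I) (projModule (PathAlgebra.vertexIdem I) j))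
          (projModule (PathAlgebra.vertexIdem I) j),
        (N : Set (projModule (PathAlgebra.vertexIdem I) j)) = pathModule I (p.comp q) := by
  obtain ⟨o, h⟩ := hA.hasMinimalSocles PathAlgebra.vertexIdem_mul_self
    PathAlgebra.sum_vertexIdem fun l =>
    ⟨PathAlgebra.isSimpleModule_simpleModule hI l, PathAlgebra.vertexIdem_smul_simpleModule hI l⟩
  have hloop := PathAlgebra.isEmpty_loop hI hA
  obtain ⟨p₀, hp₀⟩ := exists_rightInj_path h hji
  obtain ⟨q₀, hq₀⟩ := exists_leftInj_path h hki
  refine ⟨⟨p₀, isIncreasingPath_of_rightInj h p₀ hp₀⟩,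
    ⟨q₀, isDecliningPath_of_leftInj h q₀ hq₀⟩, fun p q hp hq => ?_⟩
  have hstable := map_pathModule_le h hI hloop hji p q hp hq
  exact ⟨hstable,
    { carrier := pathModule I (p.comp q)
      add_mem' := add_mem
      zero_mem' := zero_mem _
      smul_mem' := fun F _ hx => hstable F (Submodule.mem_map_of_mem hx) }, rfl⟩
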